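/- A \emph{$k$-tunnel gadget} has finitely many states and $2k$ locations, paired by a perfect matching into $k$ \emph{tunnels}, and is given by a directed transition graph on the pairs (state, location): an edge from $(s,a)$ to $(s',b)$, allowed only if $\{a,b\}$ is a tunnel, means that in state $s$ a robot can enter at $a$ and exit at $b$, which changes the state to $s'$. Such an edge is called a \emph{transition}. It \emph{corresponds} to the \emph{traversal} $(a,b)$ of the tunnel $\{a,b\}$ in state $s$; several transitions may correspond to the same traversal. A traversal is \emph{available} in a state if at least one transition from that state corresponds to it, and a tunnel is \emph{open} in a state if at least one of its two traversals is available there. The gadget is a \emph{DAG gadget} if its state-transition graph (which has an edge from $s$ to $s'$ for each transition from $s$ to $s'$) has no directed cycle. A \emph{distant opening} is a transition from $s$ to $s'$ across a tunnel such that some traversal of a different tunnel is not available in $s$ but is available in $s'$. A \emph{forced distant closing} in a state $s$ consists of a traversal of a tunnel $t$ that is available in $s$, and a set of tunnels other than $t$ with, for each tunnel in the set, a choice of one traversal of it that is available in $s$, such that for every transition from $s$ to a state $s'$ that corresponds to the given traversal of $t$, at least one of the chosen traversals is not available in $s'$. \textbf{Theorem.} (1) There is a polynomial-time algorithm that decides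 whether a given $k$-tunnel DAG gadget (where $k$ is part of the input) has a distant opening or has a forced distant closing in some state (this is the criterion for $1$-player motion planning with the gadget to be hard). Precisely, there is a (multi-stack) Turing machine that decides this in time polynomial in the length of the description of the gadget, which consists of the number of states and the number $k$ of tunnels in unary, followed by the table of the transition graph. (2) Let a $k$-tunnel DAG gadget without distant openings and a state $s$ of it be given such that no state reachable from $s$ (including $s$ itself) has a forced distant closing. If $m$ tunnels are open in $s$, then at least $2^{m}$ states are reachable from $s$ (including $s$ itself). -/

import Mathlib

/-- A `k`-tunnel gadget with finitely many states, given by its transition graph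
(`k = numTunnels`). It has `2 * k` locations; the two ends of tunnel `t` are `(t, false)` and
`(t, true)`. Since a robot that enters tunnel `t` at one end leaves it at the other end, a pair
`(t, d)` also names a direction in which tunnel `t` can be traversed: enter at `(t, d)`, exit at
`(t, !d)`. The table entry `trans s (t, d) s'` says whether the transition graph has the edge from
`(s, (t, d))` to `(s', (t, !d))`. A gadget may be nondeterministic. -/
structure TunnelGadget where
  numStates : ℕ
  numTunnels : ℕ
  trans : Fin numStates → Fin numTunnels × Bool → Fin numStates → Bool

namespace TunnelGadget

variable (G : TunnelGadget)

/-- The edges of the state-transition graph. -/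
def Step (s s' : Fin G.numStates) : Prop :=
  ∃ p, G.trans s p s' = true

/-- `s'` can be reached from `s` by a (possibly empty) sequence of transitions. -/
def Reachable (s s' : Fin G.numStates) : Prop :=
  Relation.ReflTransGen G.Step s s'

/-- The state-transition graph has no directed cycle. -/
def IsDAG : Prop :=
  ∀ s, ¬ Relation.TransGen G.Step s s

/-- Tunnel `p.1` can be traversed in the direction `p.2` in state `s`, i.e. `p` is a traversal in
state `s`. -/
def CanTraverse (s : Fin G.numStates) (p : Fin G.numTunnels × Bool) : Prop :=
  ∃ s', G.trans s p s' = true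

/-- Tunnel `t` is open in state `s`: it can be traversed in at least one direction. -/
def IsOpen (s : Fin G.numStates) (t : Fin G.numTunnels) : Prop :=
  ∃ d, G.CanTraverse s (t, d)

/-- Some transition across a tunnel makes a traversal of a different tunnel possible that was not
possible before. -/
def HasDistantOpening : Prop :=
  ∃ (s s' : Fin G.numStates) (p q : Fin G.numTunnels × Bool),
    G.trans s p s' = true ∧ q.1 ≠ p.1 ∧ ¬ G.CanTraverse s q ∧ G.CanTraverse s' q

/-- A forced distant closing in state `s`: a traversal `p` in `s`, and an orientation of a set `A`
of other tunnels (for each `u ∈ A`, a traversal `(u, o u)` in `s`), such that each transition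
corresponding to `p` closes some traversal in the orientation. -/
def ForcedDistantClosingAt (s : Fin G.numStates) : Prop :=
  ∃ (p : Fin G.numTunnels × Bool) (A : Finset (Fin G.numTunnels)) (o : Fin G.numTunnels → Bool),
    G.CanTraverse s p ∧ p.1 ∉ A ∧ (∀ u ∈ A, G.CanTraverse s (u, o u)) ∧
      ∀ s', G.trans s p s' = true → ∃ u ∈ A, ¬ G.CanTraverse s' (u, o u)

def HasForcedDistantClosing : Prop :=
  ∃ s, G.ForcedDistantClosingAt s

/-- The description of a gadget as a bit string: the number of states and the number of tunnels in
unary, each ended by `false`, and then the table of the transition graph, row by row. -/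
def encode : List Bool :=
  List.replicate G.numStates true ++ [false] ++
  List.replicate G.numTunnels true ++ [false] ++
  (List.finRange G.numStates).flatMap fun s =>
    (List.finRange G.numTunnels).flatMap fun t =>
      [false, true].flatMap fun d =>
        (List.finRange G.numStates).map fun s' => G.trans s (t, d) s'

end TunnelGadget

/-!
**The lower bound.** Suppose that no distant opening exists and that no state reachable from `s` has
a forced distant closing. Pick an open tunnel `t`. On the one hand, keep one traversal of `t`
available from now on. On the other hand, traverse `t` until it is closed; as there is no forced
distant closing, this can be done while any chosen traversals of the other open tunnels stay
available, and as there is no distant opening, `t` then remains closed. The two options lead to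
disjoint sets of states, and in each of them the remaining open tunnels can be treated in the same
way, so that the number of states doubles with each open tunnel. The induction
(`two_pow_card_le_of_keep`) carries along the set of traversals that are to be kept.

**The algorithm.** Distant openings are found by going through all pairs of states and traversals.
If there is none, then by the lower bound a state with `m` open tunnels and `2 ^ m` larger than the
number of states yields a forced distant closing somewhere. If there is no such state either, then
every state admits at most as many choices of directions for its open tunnels as there are states,
and all of them can be tried; the digits of a binary number below `2 ^ m` encode such a choice
(`TunnelGadget.Criterion`, `criterion_iff`).

**Polynomial time.** All numbers that this algorithm handles, the positions in the description of
the gadget included, are at most the length of the input. It can therefore be carried out by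
finitely many two-way heads on the read-only input word, where the position of a head serves as a
number. `HeadProgram` is a structured programming language for such heads. A head is represented by
two stacks that hold the parts of the input before and after it, which makes each basic operation a
single step of a stack machine (`HeadProgram.Exec.runFor_code`, `HeadProgram.polyTime`). The
functions on tuples of numbers that are computed by head programs (`HeadComputable`) are closed
under primitive recursion (`HeadComputable.natRec`), as long as the values stay within the length of
the input. Hence they are closed under arithmetic cut off at that length, and the predicates decided
by head programs are closed under bounded quantifiers, in which the criterion is written.
-/

/-! ### Counting reachable states -/

namespace TunnelGadget

variable {G : TunnelGadget}

/-- Without distant openings a closed tunnel stays closed: it cannot be traversed itself, and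
traversals of other tunnels do not open it. -/
theorem not_isOpen_of_reachable (hno : ¬ G.HasDistantOpening) {s s' : Fin G.numStates}
    {t : Fin G.numTunnels} (h : G.Reachable s s') (hs : ¬ G.IsOpen s t) : ¬ G.IsOpen s' t := by
  induction h with
  | refl => exact hs
  | @tail b c _ hbc ih =>
    obtain ⟨p, hp⟩ := hbc
    rintro ⟨d, hd⟩
    refine hno ⟨b, c, p, (t, d), hp, ?_, fun h => ih ⟨d, h⟩, hd⟩
    rintro rfl
    exact ih ⟨p.2, c, hp⟩

theorem wellFounded_step (hG : G.IsDAG) :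
    WellFounded fun s' s : Fin G.numStates => G.Step s s' := by
  have : Std.Irrefl (Relation.TransGen fun s' s : Fin G.numStates => G.Step s s') :=
    ⟨fun s h => hG s (Relation.transGen_swap.1 h)⟩
  exact WellFounded.mono (Finite.wellFounded_of_trans_of_irrefl
    (Relation.TransGen fun s' s : Fin G.numStates => G.Step s s'))
    fun _ _ h => Relation.TransGen.single h

/-- Traversing the tunnel `t` again and again, one can close it without losing the traversals
chosen for the tunnels in a set `A`. -/
theorem exists_reachable_closed (hG : G.IsDAG) {s : Fin G.numStates}
    (hF : ∀ s', G.Reachable s s' → ¬ G.ForcedDistantClosingAt s')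
    (A : Finset (Fin G.numTunnels)) (o : Fin G.numTunnels → Bool) {t : Fin G.numTunnels}
    (htA : t ∉ A) (hA : ∀ u ∈ A, G.CanTraverse s (u, o u)) :
    ∃ s', G.Reachable s s' ∧ (∀ u ∈ A, G.CanTraverse s' (u, o u)) ∧ ¬ G.IsOpen s' t := by
  induction s using (wellFounded_step hG).induction with
  | _ s ih =>
    by_cases ht : G.IsOpen s t
    · obtain ⟨d, hd⟩ := ht
      have hs := hF s Relation.ReflTransGen.refl
      simp only [ForcedDistantClosingAt, not_exists, not_and, not_forall] at hs
      obtain ⟨s', hs', hs'A⟩ := hs (t, d) A o hd htA hA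
      push Not at hs'A
      have hstep : G.Step s s' := ⟨_, hs'⟩
      obtain ⟨s'', h1, h2⟩ := ih s' hstep
        (fun x hx => hF x (Relation.ReflTransGen.head hstep hx)) hs'A
      exact ⟨s'', Relation.ReflTransGen.head hstep h1, h2⟩
    · exact ⟨s, Relation.ReflTransGen.refl, hA, ht⟩

/-- The induction behind the lower bound: among the states reachable from `s`, those in which the
traversals chosen for the tunnels in `B` are still available number at least `2 ^ |U|`, for every
set `U` of open tunnels outside `B`. For the induction step pick `t ∈ U`: half of the states keep
a traversal of `t` available, the other half have `t` closed. -/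
theorem two_pow_card_le_of_keep (hG : G.IsDAG) (hno : ¬ G.HasDistantOpening)
    (U : Finset (Fin G.numTunnels)) (B : Finset (Fin G.numTunnels)) (hUB : Disjoint U B)
    (o : Fin G.numTunnels → Bool) (s : Fin G.numStates)
    (hF : ∀ s', G.Reachable s s' → ¬ G.ForcedDistantClosingAt s')
    (hU : ∀ u ∈ U, G.IsOpen s u) (hB : ∀ u ∈ B, G.CanTraverse s (u, o u)) :
    2 ^ U.card ≤ {s' | G.Reachable s s' ∧ ∀ u ∈ B, G.CanTraverse s' (u, o u)}.ncard := by
  classical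
  induction U using Finset.induction_on generalizing B o s with
  | empty =>
    simp only [Finset.card_empty, pow_zero]
    exact (Set.ncard_pos).2 ⟨s, Relation.ReflTransGen.refl, hB⟩
  | @insert t U htU ih =>
    obtain ⟨d, hd⟩ := hU t (Finset.mem_insert_self t U)
    rw [Finset.disjoint_insert_left] at hUB
    obtain ⟨htB, hUB⟩ := hUB
    have hU' : ∀ u ∈ U, G.IsOpen s u := fun u hu => hU u (Finset.mem_insert_of_mem hu)
    have hne : ∀ {u}, u ∈ B → u ≠ t := fun hu h => htB (h ▸ hu)
    have h1 := ih (insert t B) (by simp [htU, hUB]) (Function.update o t d) s hF hU' (by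
      intro u hu
      rcases Finset.mem_insert.1 hu with rfl | hu
      · simpa using hd
      · simpa [Function.update_of_ne (hne hu)] using hB u hu)
    -- The tunnels of `U` may keep any of their available traversals.
    have hdir : ∀ u, ∃ e, u ∈ U → G.CanTraverse s (u, e) := fun u => by
      by_cases hu : u ∈ U
      · exact (hU' u hu).imp fun _ h _ => h
      · exact ⟨true, fun h => absurd h hu⟩
    choose e he using hdir
    obtain ⟨s', hs', hA, ht⟩ := exists_reachable_closed hG hF (U ∪ B)
      (fun u => if u ∈ U then e u else o u) (t := t) (by simp [htU, htB]) (by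
        intro u hu
        by_cases huU : u ∈ U
        · simpa [huU] using he u huU
        · simpa [huU] using hB u (by simpa [huU] using hu))
    have hUB' : ∀ u ∈ B, u ∉ U := fun u hu h => Finset.disjoint_left.1 hUB h hu
    have h2 := ih B hUB o s' (fun x hx => hF x (hs'.trans hx))
      (fun u hu => ⟨e u, by simpa [hu] using hA u (by simp [hu])⟩)
      (fun u hu => by simpa [hUB' u hu] using hA u (by simp [hu]))
    have hdisj : Disjoint
        {x | G.Reachable s x ∧ ∀ u ∈ insert t B, G.CanTraverse x (u, Function.update o t d u)}
        {x | G.Reachable s' x ∧ ∀ u ∈ B, G.CanTraverse x (u, o u)} := by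
      rw [Set.disjoint_left]
      rintro x ⟨_, hx⟩ ⟨hx', _⟩
      exact not_isOpen_of_reachable hno hx' ht ⟨_, hx t (Finset.mem_insert_self t B)⟩
    rw [Finset.card_insert_of_notMem htU, pow_succ, mul_two]
    refine (Nat.add_le_add h1 h2).trans ?_
    rw [← Set.ncard_union_eq hdisj]
    refine Set.ncard_le_ncard ?_
    rintro x (⟨hx, hxB⟩ | ⟨hx, hxB⟩)
    · refine ⟨hx, fun u hu => ?_⟩
      simpa [Function.update_of_ne (hne hu)] using hxB u (Finset.mem_insert_of_mem hu)
    · exact ⟨hs'.trans hx, hxB⟩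

theorem two_pow_ncard_isOpen_le (hG : G.IsDAG) (hno : ¬ G.HasDistantOpening)
    (s : Fin G.numStates) (hF : ∀ s', G.Reachable s s' → ¬ G.ForcedDistantClosingAt s') :
    2 ^ {t | G.IsOpen s t}.ncard ≤ {s' | G.Reachable s s'}.ncard := by
  classical
  have h := two_pow_card_le_of_keep hG hno (Finset.univ.filter (G.IsOpen s)) ∅ (by simp)
    (fun _ => true) s hF (by simp) (by simp)
  have e : {t | G.IsOpen s t} = ↑(Finset.univ.filter (G.IsOpen s)) := by ext; simp
  rw [e, Set.ncard_coe_finset]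
  simpa using h

end TunnelGadget

/-! ### Head programs -/

/-- A test on a head that reads an input word. -/
inductive HeadTest
  | pos
  | inside
  | bit

/-- `t.Holds w x`: the head at position `x` of the word `w` passes the test `t`, i.e. it is not at
the left end of the word, is not behind its last letter, or reads the letter `true`. -/
def HeadTest.Holds (w : List Bool) (x : ℕ) : HeadTest → Prop
  | pos => x ≠ 0
  | inside => x < w.length
  | bit => w[x]? = some true

/-- Programs that move finitely many two-way heads on a read-only input word. The heads are indexed
by natural numbers. The position of a head, between `0` and the length of the word, also serves as
a number. -/
inductive HeadProgram
  | skip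
  | right (r : ℕ)
  | left (r : ℕ)
  | seq (c d : HeadProgram)
  | ite (t : HeadTest) (r : ℕ) (c d : HeadProgram)
  | loop (t : HeadTest) (r : ℕ) (c : HeadProgram)

namespace HeadProgram

open Function (update)

/-- `Exec w c st st' n`: on the word `w`, the program `c` moves the heads from the positions `st` to
the positions `st'` in `n` steps. A head at an end of the word does not move beyond it. -/
inductive Exec (w : List Bool) : HeadProgram → (ℕ → ℕ) → (ℕ → ℕ) → ℕ → Prop
  | skip (st) : Exec w skip st st 1
  | right (r st) : Exec w (right r) st (update st r (min (st r + 1) w.length)) 1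
  | left (r st) : Exec w (left r) st (update st r (st r - 1)) 1
  | seq {c d st₁ st₂ st₃ m n} : Exec w c st₁ st₂ m → Exec w d st₂ st₃ n →
      Exec w (seq c d) st₁ st₃ (m + n)
  | ite_pos {t r c d st₁ st₂ n} : t.Holds w (st₁ r) → Exec w c st₁ st₂ n →
      Exec w (ite t r c d) st₁ st₂ (1 + n)
  | ite_neg {t r c d st₁ st₂ n} : ¬ t.Holds w (st₁ r) → Exec w d st₁ st₂ n →
      Exec w (ite t r c d) st₁ st₂ (1 + n)
  | loop_done {t r c st} : ¬ t.Holds w (st r) → Exec w (loop t r c) st st 1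
  | loop_step {t r c st₁ st₂ st₃ m n} : t.Holds w (st₁ r) → Exec w c st₁ st₂ m →
      Exec w (loop t r c) st₂ st₃ n → Exec w (loop t r c) st₁ st₃ (1 + m + n)

theorem Exec.le_length {w : List Bool} {c : HeadProgram} {st st' : ℕ → ℕ} {n : ℕ}
    (h : Exec w c st st' n) (hst : ∀ i, st i ≤ w.length) : ∀ i, st' i ≤ w.length := by
  induction h with
  | skip => exact hst
  | right r st =>
    intro i
    by_cases hi : i = r
    · subst hi; simp
    · simpa [hi] using hst i
  | left r st =>
    intro i
    by_cases hi : i = r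
    · subst hi; simpa using (Nat.sub_le _ _).trans (hst i)
    · simpa [hi] using hst i
  | seq _ _ ih₁ ih₂ => exact ih₂ (ih₁ hst)
  | ite_pos _ _ ih => exact ih hst
  | ite_neg _ _ ih => exact ih hst
  | loop_done => exact hst
  | loop_step _ _ _ ih₁ ih₂ => exact ih₂ (ih₁ hst)

/-! ### Compiling head programs to stack machines -/

/-- All heads that occur in the program have index at most `R`. -/
def BoundedBy (R : ℕ) : HeadProgram → Prop
  | skip => True
  | right r => r ≤ R
  | left r => r ≤ R
  | seq c d => c.BoundedBy R ∧ d.BoundedBy R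
  | ite _ r c d => r ≤ R ∧ c.BoundedBy R ∧ d.BoundedBy R
  | loop _ r c => r ≤ R ∧ c.BoundedBy R

theorem BoundedBy.mono {R R' : ℕ} (h : R ≤ R') {c : HeadProgram} (hc : c.BoundedBy R) :
    c.BoundedBy R' := by
  induction c with
  | skip => trivial
  | right r => exact le_trans hc h
  | left r => exact le_trans hc h
  | seq c d ihc ihd => exact ⟨ihc hc.1, ihd hc.2⟩
  | ite t r c d ihc ihd => exact ⟨hc.1.trans h, ihc hc.2.1, ihd hc.2.2⟩
  | loop t r c ih => exact ⟨hc.1.trans h, ih hc.2⟩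

theorem exists_boundedBy (c : HeadProgram) : ∃ R, c.BoundedBy R := by
  induction c with
  | skip => exact ⟨0, trivial⟩
  | right r => exact ⟨r, le_refl r⟩
  | left r => exact ⟨r, le_refl r⟩
  | seq c d ihc ihd =>
    obtain ⟨R, hR⟩ := ihc
    obtain ⟨R', hR'⟩ := ihd
    exact ⟨max R R', hR.mono (le_max_left _ _), hR'.mono (le_max_right _ _)⟩
  | ite t r c d ihc ihd =>
    obtain ⟨R, hR⟩ := ihc
    obtain ⟨R', hR'⟩ := ihd
    exact ⟨max r (max R R'), le_max_left _ _, hR.mono (by simp), hR'.mono (by simp)⟩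
  | loop t r c ih =>
    obtain ⟨R, hR⟩ := ih
    exact ⟨max r R, le_max_left _ _, hR.mono (le_max_right _ _)⟩

/-- The stacks of the machine: `none` is the stack for input and output, and a head `i` is
represented by the two stacks `(i, false)` and `(i, true)`. -/
abbrev Stack (R : ℕ) : Type := Option (Fin (R + 1) × Bool)

/-- Statements of the machine; its internal memory holds the letter that was read last. -/
abbrev Code (R : ℕ) (Λ : Type) : Type := Turing.TM2.Stmt (fun _ : Stack R => Bool) Λ (Option Bool)

/-- The stack that holds the part of the input word before (`b = false`) or after (`b = true`) the
head `r`. -/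
def headStack (R r : ℕ) (b : Bool) : Stack R := some (Fin.ofNat (R + 1) r, b)

/-- The stack contents that represent the head positions `st` on the word `w`. The stack for the
part of the word before a head has the letter next to the head on top. -/
def tape (R : ℕ) (w : List Bool) (st : ℕ → ℕ) : Stack R → List Bool
  | none => []
  | some (i, false) => (w.take (st i)).reverse
  | some (i, true) => w.drop (st i)

/-- The labels of a compiled program. -/
def Label : HeadProgram → Type
  | skip => Unit
  | right _ => Unit
  | left _ => Unit
  | seq c d => c.Label ⊕ d.Label
  | ite _ _ c d => Option (c.Label ⊕ d.Label)
  | loop _ _ c => Option c.Label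

/-- There are finitely many labels. -/
@[reducible]
def labelFintype : (c : HeadProgram) → Fintype c.Label
  | skip => inferInstanceAs (Fintype Unit)
  | right _ => inferInstanceAs (Fintype Unit)
  | left _ => inferInstanceAs (Fintype Unit)
  | seq c d =>
    letI := labelFintype c
    letI := labelFintype d
    inferInstanceAs (Fintype (c.Label ⊕ d.Label))
  | ite _ _ c d =>
    letI := labelFintype c
    letI := labelFintype d
    inferInstanceAs (Fintype (Option (c.Label ⊕ d.Label)))
  | loop _ _ c =>
    letI := labelFintype c
    inferInstanceAs (Fintype (Option c.Label))

instance (c : HeadProgram) : Fintype c.Label := labelFintype c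

/-- The label at which a compiled program starts. -/
def entry : (c : HeadProgram) → c.Label
  | skip => ()
  | right _ => ()
  | left _ => ()
  | seq c _ => Sum.inl c.entry
  | ite _ _ _ _ => none
  | loop _ _ _ => none

variable {R : ℕ} {Λ : Type}

/-- Clear the internal memory and go to the label `l`. -/
def clearGoto (l : Λ) : Code R Λ := .load (fun _ => none) (.goto fun _ => l)

/-- Move the top letter, if there is one, from the stack `k` to the stack `k'`. -/
def moveLetter (k k' : Stack R) (l : Λ) : Code R Λ :=
  .pop k (fun _ x => x) (.branch Option.isSome (.push k' (fun x => x.getD false) (clearGoto l))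
    (clearGoto l))

/-- Branch according to the test `t` on the head `r`. -/
def testCode (t : HeadTest) (r : ℕ) (l l' : Λ) : Code R Λ :=
  match t with
  | .pos => .peek (headStack R r false) (fun _ x => x)
      (.branch Option.isSome (clearGoto l) (clearGoto l'))
  | .inside => .peek (headStack R r true) (fun _ x => x)
      (.branch Option.isSome (clearGoto l) (clearGoto l'))
  | .bit => .peek (headStack R r true) (fun _ x => x)
      (.branch (fun x => x == some true) (clearGoto l) (clearGoto l'))

/-- The compiled program: `emb` says how the labels of the program are named in the surrounding
machine, and `exit` is the label to go to in the end. -/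
def code (R : ℕ) {Λ : Type} : (c : HeadProgram) → (emb : c.Label → Λ) → (exit : Λ) →
    c.Label → Code R Λ
  | skip, _, exit => fun _ => clearGoto exit
  | right r, _, exit => fun _ => moveLetter (headStack R r true) (headStack R r false) exit
  | left r, _, exit => fun _ => moveLetter (headStack R r false) (headStack R r true) exit
  | seq c d, emb, exit => Sum.elim (c.code R (emb ∘ Sum.inl) (emb (Sum.inr d.entry)))
      (d.code R (emb ∘ Sum.inr) exit)
  | ite t r c d, emb, exit => fun l => match l with
    | none => testCode t r (emb (some (Sum.inl c.entry))) (emb (some (Sum.inr d.entry)))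
    | some (Sum.inl l) => c.code R (fun l => emb (some (Sum.inl l))) exit l
    | some (Sum.inr l) => d.code R (fun l => emb (some (Sum.inr l))) exit l
  | loop t r c, emb, exit => fun l => match l with
    | none => testCode t r (emb (some c.entry)) exit
    | some l => c.code R (fun l => emb (some l)) (emb none) l

/-- The configuration with clear internal memory at the label `l` that represents the head
positions `st`. -/
def config (R : ℕ) {Λ : Type} (w : List Bool) (l : Λ) (st : ℕ → ℕ) :
    Turing.TM2.Cfg (fun _ : Stack R => Bool) Λ (Option Bool) :=
  ⟨some l, none, tape R w st⟩

theorem ofNat_eq_iff {r : ℕ} (hr : r ≤ R) (i : Fin (R + 1)) :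
    i = Fin.ofNat (R + 1) r ↔ (i : ℕ) = r := by
  rw [Fin.ext_iff, Fin.val_ofNat, Nat.mod_eq_of_lt (Nat.lt_succ_of_le hr)]

theorem tape_headStack_false {w : List Bool} {st : ℕ → ℕ} {r : ℕ} (hr : r ≤ R) :
    tape R w st (headStack R r false) = (w.take (st r)).reverse := by
  simp [headStack, tape, Nat.mod_eq_of_lt (Nat.lt_succ_of_le hr)]

theorem tape_headStack_true {w : List Bool} {st : ℕ → ℕ} {r : ℕ} (hr : r ≤ R) :
    tape R w st (headStack R r true) = w.drop (st r) := by
  simp [headStack, tape, Nat.mod_eq_of_lt (Nat.lt_succ_of_le hr)]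

theorem update_tape {w : List Bool} {st : ℕ → ℕ} {r : ℕ} (hr : r ≤ R) (x : ℕ) :
    tape R w (update st r x) = update (update (tape R w st) (headStack R r true) (w.drop x))
      (headStack R r false) (w.take x).reverse := by
  funext k
  rcases k with _ | ⟨i, b⟩
  · simp [tape, headStack]
  · by_cases hi : (i : ℕ) = r
    · have := (ofNat_eq_iff hr i).2 hi
      rw [Fin.ofNat_eq_cast] at this
      cases b <;> simp [tape, headStack, Function.update_apply, hi, ← this]
    · have this' := mt (ofNat_eq_iff hr i).1 hi
      rw [Fin.ofNat_eq_cast] at this'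
      cases b <;> simp [tape, headStack, hi, this']

theorem stepAux_testCode {w : List Bool} {st : ℕ → ℕ} {r : ℕ} (hr : r ≤ R)
    (hst : ∀ i, st i ≤ w.length) (t : HeadTest) (l l' : Λ) [Decidable (t.Holds w (st r))] :
    Turing.TM2.stepAux (testCode (R := R) t r l l') none (tape R w st) =
      config R w (if t.Holds w (st r) then l else l') st := by
  cases t with
  | pos =>
    by_cases h : st r = 0
    · simp [testCode, tape_headStack_false hr, HeadTest.Holds, clearGoto, config, h]
    · have h' : (w.take (st r)).reverse ≠ [] := by
        have := hst r
        intro h'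
        have := congrArg List.length h'
        simp at this
        rcases this with h'' | h''
        · exact h h''
        · subst h''
          simp at *
          omega
      obtain ⟨x, xs, hx⟩ := List.exists_cons_of_ne_nil h'
      simp only [testCode, Turing.TM2.stepAux, tape_headStack_false hr, hx]
      simp [HeadTest.Holds, clearGoto, config, h]
  | inside =>
    by_cases h : st r < w.length
    · simp [testCode, tape_headStack_true hr, HeadTest.Holds, clearGoto, config, h]
    · simp [testCode, tape_headStack_true hr, HeadTest.Holds, clearGoto, config, h]
  | bit =>
    by_cases h : w[st r]? = some true
    · simp [testCode, tape_headStack_true hr, HeadTest.Holds, clearGoto, config, h]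
    · have h' : (w[st r]? == some true) = false := by simpa using h
      simp [testCode, tape_headStack_true hr, HeadTest.Holds, clearGoto, config, h, h']

theorem stepAux_right {w : List Bool} {st : ℕ → ℕ} {r : ℕ} (hr : r ≤ R) (l : Λ)
    (hst : ∀ i, st i ≤ w.length) :
    Turing.TM2.stepAux (moveLetter (headStack R r true) (headStack R r false) l) none
      (tape R w st) = config R w l (update st r (min (st r + 1) w.length)) := by
  have hne : headStack R r false ≠ headStack R r true := by simp [headStack]
  by_cases h : st r < w.length
  · have e : w.drop (st r) = w[st r] :: w.drop (st r + 1) := List.drop_eq_getElem_cons h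
    simp only [moveLetter, Turing.TM2.stepAux, tape_headStack_true hr, e, clearGoto, config,
      update_tape hr, min_eq_left (Nat.succ_le_of_lt h), List.head?_cons, List.tail_cons,
      Option.isSome_some, cond_true, Option.getD_some, Function.update_of_ne hne,
      tape_headStack_false hr]
    rw [← List.take_concat_get' _ _ h, List.reverse_append, List.reverse_singleton,
      List.singleton_append]
  · have e : st r = w.length := le_antisymm (hst r) (not_lt.1 h)
    have e' : update st r (min (st r + 1) w.length) = st := by
      rw [min_eq_right (by omega), ← e, Function.update_eq_self]
    have e2 : w.drop (st r) = [] := by simp [e]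
    have e3 : update (tape R w st) (headStack R r true) [] = tape R w st := by
      rw [Function.update_eq_self_iff, tape_headStack_true hr, e2]
    simp only [moveLetter, Turing.TM2.stepAux, tape_headStack_true hr, e2, clearGoto, config, e',
      List.head?_nil, List.tail_nil, Option.isSome_none, cond_false, e3]

theorem stepAux_left {w : List Bool} {st : ℕ → ℕ} {r : ℕ} (hr : r ≤ R) (l : Λ)
    (hst : ∀ i, st i ≤ w.length) :
    Turing.TM2.stepAux (moveLetter (headStack R r false) (headStack R r true) l) none
      (tape R w st) = config R w l (update st r (st r - 1)) := by
  have hne : headStack R r true ≠ headStack R r false := by simp [headStack]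
  rcases h : st r with _ | x
  · have e' : update st r (0 - 1) = st := by
      rw [Function.update_eq_self_iff, h]
    have e2 : (w.take (st r)).reverse = [] := by simp [h]
    have e3 : update (tape R w st) (headStack R r false) [] = tape R w st := by
      rw [Function.update_eq_self_iff, tape_headStack_false hr, e2]
    simp only [moveLetter, Turing.TM2.stepAux, tape_headStack_false hr, e2, clearGoto, config, e',
      List.head?_nil, List.tail_nil, Option.isSome_none, cond_false, e3]
  · have hx : x < w.length := by have := hst r; omega
    have e : (w.take (x + 1)).reverse = w[x] :: (w.take x).reverse := by
      rw [← List.take_concat_get' _ _ hx]; simp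
    have e2 : w.drop x = w[x] :: w.drop (x + 1) := List.drop_eq_getElem_cons hx
    simp only [moveLetter, Turing.TM2.stepAux, tape_headStack_false hr, h, e, clearGoto, config,
      update_tape hr, Nat.add_sub_cancel, e2, List.head?_cons, List.tail_cons,
      Option.isSome_some, cond_true, Option.getD_some, Function.update_of_ne hne,
      tape_headStack_true hr, Function.update_comm hne]

/-- Running a machine for `n` steps, in the form used in `StateTransition.EvalsTo`. -/
abbrev runFor (M : Λ → Code R Λ) (n : ℕ)
    (a : Turing.TM2.Cfg (fun _ : Stack R => Bool) Λ (Option Bool)) :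
    Option (Turing.TM2.Cfg (fun _ : Stack R => Bool) Λ (Option Bool)) :=
  (flip bind (Turing.TM2.step M))^[n] (some a)

theorem runFor_add {M : Λ → Code R Λ} {m n : ℕ}
    {a b : Turing.TM2.Cfg (fun _ : Stack R => Bool) Λ (Option Bool)}
    (h : runFor M m a = some b) : runFor M (m + n) a = runFor M n b := by
  rw [runFor, Nat.add_comm m n, Function.iterate_add_apply]
  exact congrArg _ h

theorem runFor_one {M : Λ → Code R Λ} {w : List Bool} {l : Λ} {st : ℕ → ℕ} :
    runFor M 1 (config R w l st) = some (Turing.TM2.stepAux (M l) none (tape R w st)) := rfl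

/-- A compiled program simulates the head program step by step. -/
theorem Exec.runFor_code {w : List Bool} {c : HeadProgram} {st st' : ℕ → ℕ} {n : ℕ}
    (h : Exec w c st st' n) (hst : ∀ i, st i ≤ w.length) (hc : c.BoundedBy R) (M : Λ → Code R Λ)
    (emb : c.Label → Λ) (exit : Λ) (hM : ∀ l, M (emb l) = c.code R emb exit l) :
    runFor M n (config R w (emb c.entry) st) = some (config R w exit st') := by
  classical
  induction h generalizing exit with
  | skip st =>
    rw [runFor_one, hM]
    rfl
  | right r st =>
    rw [runFor_one, hM]
    exact congrArg _ (stepAux_right hc exit hst)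
  | left r st =>
    rw [runFor_one, hM]
    exact congrArg _ (stepAux_left hc exit hst)
  | @seq c d st₁ st₂ st₃ m n h₁ h₂ ih₁ ih₂ =>
    exact (runFor_add
      (ih₁ hst hc.1 (emb ∘ Sum.inl) (emb (Sum.inr d.entry)) fun l => hM (Sum.inl l))).trans
      (ih₂ (h₁.le_length hst) hc.2 (emb ∘ Sum.inr) exit fun l => hM (Sum.inr l))
  | @ite_pos t r c d st₁ st₂ n ht h ih =>
    rw [runFor_add (b := config R w (emb (some (Sum.inl c.entry))) st₁)]
    · exact ih hst hc.2.1 (fun l => emb (some (Sum.inl l))) exit fun l => hM (some (Sum.inl l))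
    · rw [runFor_one, hM]
      exact congrArg _ ((stepAux_testCode hc.1 hst t _ _).trans (by rw [if_pos ht]))
  | @ite_neg t r c d st₁ st₂ n ht h ih =>
    rw [runFor_add (b := config R w (emb (some (Sum.inr d.entry))) st₁)]
    · exact ih hst hc.2.2 (fun l => emb (some (Sum.inr l))) exit fun l => hM (some (Sum.inr l))
    · rw [runFor_one, hM]
      exact congrArg _ ((stepAux_testCode hc.1 hst t _ _).trans (by rw [if_neg ht]))
  | @loop_done t r c st ht =>
    rw [runFor_one, hM]
    exact congrArg _ ((stepAux_testCode hc.1 hst t _ _).trans (by rw [if_neg ht]))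
  | @loop_step t r c st₁ st₂ st₃ m n ht h₁ h₂ ih₁ ih₂ =>
    rw [Nat.add_assoc, runFor_add (b := config R w (emb (some c.entry)) st₁)]
    · rw [runFor_add (ih₁ hst hc.2 (fun l => emb (some l)) (emb none) fun l => hM (some l))]
      exact ih₂ (h₁.le_length hst) hc emb exit hM
    · rw [runFor_one, hM]
      exact congrArg _ ((stepAux_testCode hc.1 hst t _ _).trans (by rw [if_pos ht]))

end HeadProgram

namespace HeadProgram

variable {R : ℕ} {Λ : Type}

theorem stepAux_foldr_push (ks : List (Stack R)) (hks : ks.Nodup) (f : Option Bool → Bool)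
    (q : Code R Λ) (v : Option Bool) (S : Stack R → List Bool) :
    Turing.TM2.stepAux (ks.foldr (fun k q => .push k f q) q) v S =
      Turing.TM2.stepAux q v (fun k => if k ∈ ks then f v :: S k else S k) := by
  induction ks generalizing S with
  | nil => simp
  | cons k ks ih =>
    rw [List.nodup_cons] at hks
    simp only [List.foldr_cons, Turing.TM2.stepAux, ih hks.2]
    congr 1
    funext k'
    by_cases h : k' = k
    · subst h; simp [hks.1]
    · simp [h]

/-- Popping all stacks in `ks` at once. In the end the internal memory `v'` tells whether any of
them had a letter. -/
theorem stepAux_foldr_pop (ks : List (Stack R)) (hks : ks.Nodup)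
    (q : Code R Λ) (v : Option Bool) (S : Stack R → List Bool) :
    ∃ v' : Option Bool, (v' = none ↔ v = none ∧ ∀ k ∈ ks, S k = []) ∧
      Turing.TM2.stepAux (ks.foldr (fun k q => .pop k (fun v x => v.or x) q) q) v S =
        Turing.TM2.stepAux q v' (fun k => if k ∈ ks then (S k).tail else S k) := by
  induction ks generalizing S v with
  | nil => exact ⟨v, by simp, by simp⟩
  | cons k ks ih =>
    rw [List.nodup_cons] at hks
    obtain ⟨v', hv', h⟩ := ih hks.2 (v.or (S k).head?) (Function.update S k (S k).tail)
    refine ⟨v', ?_, ?_⟩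
    · rw [hv', Option.or_eq_none_iff, List.head?_eq_none_iff, List.forall_mem_cons, and_assoc]
      refine and_congr_right fun _ => and_congr_right fun _ => forall₂_congr fun k' hk' => ?_
      rw [Function.update_of_ne]
      rintro rfl
      exact hks.1 hk'
    · simp only [List.foldr_cons, Turing.TM2.stepAux, h]
      congr 1
      funext k'
      by_cases h : k' = k
      · subst h; simp [hks.1]
      · simp [h]

/-- The stacks that a head enters when it is moved to the right. -/
noncomputable def leftStacks (R : ℕ) : List (Stack R) :=
  (Finset.univ : Finset (Fin (R + 1))).toList.map fun i => some (i, false)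

theorem nodup_leftStacks : (leftStacks R).Nodup :=
  (Finset.nodup_toList _).map fun i j h => by simpa using h

/-- All stacks that represent heads. -/
noncomputable def headStacks (R : ℕ) : List (Stack R) :=
  (Finset.univ : Finset (Fin (R + 1) × Bool)).toList.map some

theorem nodup_headStacks : (headStacks R).Nodup :=
  (Finset.nodup_toList _).map fun i j h => by simpa using h

theorem some_mem_headStacks (p : Fin (R + 1) × Bool) : some p ∈ headStacks R := by
  simp [headStacks]

theorem none_notMem_headStacks : none ∉ headStacks R := by
  simp [headStacks]

/-- The labels of the machine for a head program: those of the compiled program, `inr none` for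
loading the input, `inr (some none)` for reading off the answer, and `inr (some (some b))` for
emptying the stacks and halting with output `b`. -/
abbrev MachineLabel (c : HeadProgram) : Type := c.Label ⊕ Option (Option Bool)

/-- The machine that copies the input word to all heads, runs the program, and answers whether the
head `0` is away from the left end of the word. -/
noncomputable def machineCode (R : ℕ) (c : HeadProgram) : MachineLabel c → Code R (MachineLabel c)
  | .inl l => c.code R Sum.inl (.inr (some none)) l
  | .inr none => .pop none (fun _ x => x) (.branch Option.isSome
      ((leftStacks R).foldr (fun k q => .push k (fun x => x.getD false) q)
        (clearGoto (.inr none)))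
      (clearGoto (.inl c.entry)))
  | .inr (some none) => testCode .pos 0 (.inr (some (some true))) (.inr (some (some false)))
  | .inr (some (some b)) => (headStacks R).foldr (fun k q => .pop k (fun v x => v.or x) q)
      (.branch Option.isSome (clearGoto (.inr (some (some b))))
        (.push none (fun _ => b) .halt))

/-- The machine of a head program as a Turing machine with finitely many stacks. -/
noncomputable def machine (R : ℕ) (c : HeadProgram) : Turing.FinTM2 where
  K := Stack R
  k₀ := none
  k₁ := none
  Γ _ := Bool
  Λ := MachineLabel c
  main := .inr none
  σ := Option Bool
  initialState := none
  m := machineCode R c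

/-- Stack contents during loading: `u` has been read, and `w` is left. -/
def loadTape (R : ℕ) (u w : List Bool) : Stack R → List Bool
  | none => w
  | some (_, false) => u.reverse
  | some (_, true) => []

theorem runFor_load (c : HeadProgram) (u w : List Bool) :
    runFor (machineCode R c) (w.length + 1) ⟨some (.inr none), none, loadTape R u w⟩ =
      some (config R (u ++ w) (.inl c.entry) fun _ => (u ++ w).length) := by
  induction w generalizing u with
  | nil =>
    refine congrArg some ?_
    simp only [machineCode, Turing.TM2.stepAux, loadTape, List.head?_nil, Option.isSome_none,
      cond_false, clearGoto, config, List.append_nil]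
    congr 1
    funext k
    rcases k with _ | ⟨i, _ | _⟩ <;> simp [loadTape, tape]
  | cons x w ih =>
    have h1 : runFor (machineCode R c) 1 ⟨some (.inr none), none, loadTape R u (x :: w)⟩ =
        some ⟨some (.inr none), none, loadTape R (u ++ [x]) w⟩ := by
      refine congrArg some ?_
      simp only [machineCode, Turing.TM2.stepAux, loadTape, List.head?_cons, Option.isSome_some,
        cond_true, stepAux_foldr_push _ nodup_leftStacks, clearGoto]
      congr 1
      funext k
      rcases k with _ | ⟨i, _ | _⟩ <;> simp [leftStacks, loadTape]
    rw [List.length_cons, Nat.add_comm, runFor_add h1, ih]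
    simp

/-- Each round of the cleaning phase removes one letter from every nonempty stack. -/
theorem runFor_clean (c : HeadProgram) (b : Bool) (N : ℕ) (S : Stack R → List Bool)
    (hS : ∀ k, (S k).length ≤ N) (hnone : S none = []) :
    ∃ n ≤ N + 1, runFor (machineCode R c) n ⟨some (.inr (some (some b))), none, S⟩ =
      some ⟨none, none, fun k => if k = none then [b] else []⟩ := by
  induction N generalizing S with
  | zero =>
    refine ⟨1, le_rfl, congrArg some ?_⟩
    obtain ⟨v', hv', h⟩ := stepAux_foldr_pop (headStacks R) nodup_headStacks
      (.branch Option.isSome (clearGoto (.inr (some (some b)))) (.push none (fun _ => b) .halt) :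
        Code R (MachineLabel c)) none S
    have hS' : ∀ k, S k = [] := fun k => List.length_eq_zero_iff.1 (Nat.le_zero.1 (hS k))
    obtain rfl := hv'.2 ⟨rfl, fun k _ => hS' k⟩
    refine h.trans ?_
    simp only [Turing.TM2.stepAux, Option.isSome_none, cond_false]
    congr 1
    funext k
    by_cases hk : k = none
    · subst hk; simp [hS']
    · simp [hk, hS']
  | succ N ih =>
    obtain ⟨v', hv', h⟩ := stepAux_foldr_pop (headStacks R) nodup_headStacks
      (.branch Option.isSome (clearGoto (.inr (some (some b)))) (.push none (fun _ => b) .halt) :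
        Code R (MachineLabel c)) none S
    rcases v' with _ | x
    · refine ⟨1, by omega, congrArg some (h.trans ?_)⟩
      have hS' : ∀ k, S k = [] := by
        rintro (_ | p)
        · exact hnone
        · exact (hv'.1 rfl).2 _ (some_mem_headStacks p)
      simp only [Turing.TM2.stepAux, Option.isSome_none, cond_false]
      congr 1
      funext k
      by_cases hk : k = none
      · subst hk; simp [hS']
      · simp [hk, hS']
    · obtain ⟨n, hn, hrun⟩ := ih (fun k => if k ∈ headStacks R then (S k).tail else S k)
        (fun k => by
          rcases k with _ | p
          · simp [none_notMem_headStacks, hnone]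
          · have := hS (some p)
            simp only [some_mem_headStacks, if_true, List.length_tail]
            omega)
        (by simp [none_notMem_headStacks, hnone])
      refine ⟨1 + n, by omega, ?_⟩
      have h1 : runFor (machineCode R c) 1 ⟨some (.inr (some (some b))), none, S⟩ =
          some ⟨some (.inr (some (some b))), none,
            fun k => if k ∈ headStacks R then (S k).tail else S k⟩ := congrArg some h
      rw [runFor_add h1, hrun]

/-- A predicate that is decided by a head program in polynomial time is decided by a multi-stack
Turing machine in polynomial time. The heads start at the right end of the input word. -/
theorem polyTime {α : Type} (ea : α → List Bool) (f : α → Bool) (c : HeadProgram)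
    (p : Polynomial ℕ)
    (h : ∀ a, ∃ st n, Exec (ea a) c (fun _ => (ea a).length) st n ∧
      n ≤ p.eval (ea a).length ∧ (f a = true ↔ st 0 ≠ 0)) :
    Nonempty (Turing.TM2ComputableInPolyTime ea Computability.encodeBool f) := by
  classical
  obtain ⟨R, hR⟩ := c.exists_boundedBy
  refine ⟨⟨⟨machine R c, Equiv.refl Bool, Equiv.refl Bool⟩,
    2 * Polynomial.X + 3 + p, fun a => Classical.choice ?_⟩⟩
  obtain ⟨st, n, hex, hn, hf⟩ := h a
  set w := ea a with hw
  have hst : ∀ i, st i ≤ w.length := hex.le_length fun _ => le_rfl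
  have h1 := runFor_load (R := R) c [] w
  have h2 := hex.runFor_code (fun _ => le_rfl) hR (machineCode R c) Sum.inl (.inr (some none))
    (fun _ => rfl)
  have h3 : runFor (machineCode R c) 1 (config R w (.inr (some none)) st) =
      some (config R w (.inr (some (some (f a)))) st) := by
    rw [runFor_one]
    refine congrArg some ((stepAux_testCode (Nat.zero_le R) hst .pos _ _).trans ?_)
    have hf' : f a = true ↔ HeadTest.pos.Holds w (st 0) := hf
    by_cases hfa : f a = true
    · rw [if_pos (hf'.1 hfa), hfa]
    · rw [if_neg (mt hf'.2 hfa), Bool.eq_false_of_not_eq_true hfa]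
  obtain ⟨m, hm, h4⟩ := runFor_clean (R := R) c (f a) w.length (tape R w st) (by
    rintro (_ | ⟨i, _ | _⟩)
    · simp [tape]
    · simp [tape, hst]
    · simp [tape]) rfl
  have hinit : Turing.initList (machine R c) (w.map (Equiv.refl Bool).invFun) =
      (⟨some (.inr none), none, loadTape R [] w⟩ :
        Turing.TM2.Cfg (fun _ : Stack R => Bool) (MachineLabel c) (Option Bool)) := by
    unfold Turing.initList
    congr 1
    funext k
    rcases k with _ | ⟨i, _ | _⟩
    · exact List.map_id w
    · rfl
    · rfl
  have hhalt : Turing.haltList (machine R c)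
        ((Computability.encodeBool (f a)).map (Equiv.refl Bool).invFun) =
      (⟨none, none, fun k => if k = none then [f a] else []⟩ :
        Turing.TM2.Cfg (fun _ : Stack R => Bool) (MachineLabel c) (Option Bool)) := by
    unfold Turing.haltList
    congr 1
  refine ⟨⟨⟨w.length + 1 + (n + (1 + m)), ?_⟩, ?_⟩⟩
  · refine Eq.trans ?_ (congrArg some hhalt.symm)
    refine (congrArg (fun x => (flip bind (machine R c).step)^[_] (some x)) hinit).trans ?_
    refine (runFor_add h1).trans ?_
    refine (runFor_add h2).trans ?_
    refine (runFor_add h3).trans h4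
  · simp only [Polynomial.eval_add, Polynomial.eval_mul, Polynomial.eval_ofNat, Polynomial.eval_X]
    omega

end HeadProgram

/-! ### Functions computed by head programs -/

namespace HeadProgram

open Function (update)

/-- From head positions that satisfy `Pre`, the program `c` reaches head positions that satisfy
`Post` in at most `b` steps. -/
def Triple (w : List Bool) (Pre : (ℕ → ℕ) → Prop) (c : HeadProgram) (b : ℕ)
    (Post : (ℕ → ℕ) → Prop) : Prop :=
  ∀ st, (∀ i, st i ≤ w.length) → Pre st → ∃ st' n, n ≤ b ∧ Exec w c st st' n ∧ Post st'

variable {w : List Bool} {Pre Mid Post : (ℕ → ℕ) → Prop} {c d : HeadProgram} {b b' : ℕ}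

theorem Triple.seq (h : Triple w Pre c b Mid) (h' : Triple w Mid d b' Post) :
    Triple w Pre (c.seq d) (b + b') Post := by
  intro st hst hP
  obtain ⟨st₁, n₁, hn₁, hex₁, h₁⟩ := h st hst hP
  obtain ⟨st₂, n₂, hn₂, hex₂, h₂⟩ := h' st₁ (hex₁.le_length hst) h₁
  exact ⟨st₂, n₁ + n₂, by omega, hex₁.seq hex₂, h₂⟩

theorem Triple.mono {Pre' Post' : (ℕ → ℕ) → Prop} (h : Triple w Pre c b Post)
    (hpre : ∀ st, (∀ i, st i ≤ w.length) → Pre' st → Pre st)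
    (hb : b ≤ b') (hpost : ∀ st, (∀ i, st i ≤ w.length) → Post st → Post' st) :
    Triple w Pre' c b' Post' := by
  intro st hst hP
  obtain ⟨st₁, n₁, hn₁, hex₁, h₁⟩ := h st hst (hpre st hst hP)
  exact ⟨st₁, n₁, hn₁.trans hb, hex₁, hpost _ (hex₁.le_length hst) h₁⟩

theorem Triple.right {r : ℕ}
    (h : ∀ st, (∀ i, st i ≤ w.length) → Pre st → Post (update st r (min (st r + 1) w.length))) :
    Triple w Pre (right r) 1 Post :=
  fun st hst hP => ⟨_, 1, le_rfl, .right r st, h st hst hP⟩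

theorem Triple.left {r : ℕ}
    (h : ∀ st, (∀ i, st i ≤ w.length) → Pre st → Post (update st r (st r - 1))) :
    Triple w Pre (left r) 1 Post :=
  fun st hst hP => ⟨_, 1, le_rfl, .left r st, h st hst hP⟩

theorem Triple.ite {t : HeadTest} {r : ℕ}
    (h : Triple w (fun st => Pre st ∧ t.Holds w (st r)) c b Post)
    (h' : Triple w (fun st => Pre st ∧ ¬ t.Holds w (st r)) d b' Post) :
    Triple w Pre (ite t r c d) (1 + b + b') Post := by
  intro st hst hP
  by_cases ht : t.Holds w (st r)
  · obtain ⟨st₁, n₁, hn₁, hex₁, h₁⟩ := h st hst ⟨hP, ht⟩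
    exact ⟨st₁, 1 + n₁, by omega, .ite_pos ht hex₁, h₁⟩
  · obtain ⟨st₁, n₁, hn₁, hex₁, h₁⟩ := h' st hst ⟨hP, ht⟩
    exact ⟨st₁, 1 + n₁, by omega, .ite_neg ht hex₁, h₁⟩

/-- The rule for loops: the invariant `I x` holds when `x` rounds remain. -/
theorem Triple.loop {t : HeadTest} {r : ℕ} (I : ℕ → (ℕ → ℕ) → Prop) (x : ℕ)
    (ht : ∀ y st, (∀ i, st i ≤ w.length) → I y st → (t.Holds w (st r) ↔ y ≠ 0))
    (h : ∀ y, Triple w (I (y + 1)) c b (I y)) :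
    Triple w (I x) (loop t r c) (x * (b + 1) + 1) (I 0) := by
  induction x with
  | zero =>
    intro st hst hI
    exact ⟨st, 1, by omega, .loop_done (by simp [ht 0 st hst hI]), hI⟩
  | succ x ih =>
    intro st hst hI
    obtain ⟨st₁, n₁, hn₁, hex₁, h₁⟩ := h x st hst hI
    obtain ⟨st₂, n₂, hn₂, hex₂, h₂⟩ := ih st₁ (hex₁.le_length hst) h₁
    refine ⟨st₂, 1 + n₁ + n₂, ?_, .loop_step ((ht _ st hst hI).2 (by simp)) hex₁ hex₂, h₂⟩
    rw [Nat.succ_mul]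
    omega

/-- Move the head `r` to the left end of the word. -/
def zero (r : ℕ) : HeadProgram := loop .pos r (left r)

theorem Triple.zero {r : ℕ} (h : ∀ st, (∀ i, st i ≤ w.length) → Pre st → Post (update st r 0)) :
    Triple w Pre (zero r) (w.length * 2 + 1) Post := by
  intro st hst hP
  obtain ⟨st', n, hn, hex, h0, hst'⟩ := Triple.loop (w := w) (t := .pos) (r := r) (c := .left r)
    (b := 1) (fun x st' => st' r = x ∧ ∀ i ≠ r, st' i = st i) (st r)
    (fun y st' _ hI => by simp [HeadTest.Holds, hI.1])
    (fun y => Triple.left fun st' _ hI => ⟨by simp [hI.1], fun i hi => by simp [hi, hI.2 i hi]⟩)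
    st hst ⟨rfl, fun _ _ => rfl⟩
  refine ⟨st', n, hn.trans ?_, hex, ?_⟩
  · have := Nat.mul_le_mul_right 2 (hst r)
    omega
  · convert h st hst hP using 1
    funext i
    by_cases hi : i = r
    · subst hi; simpa using h0
    · simp [hi, hst' i hi]

/-- Set the head `k` to the position of the head `j`, which moves to the left end. -/
def move (j k : ℕ) : HeadProgram := (zero k).seq (loop .pos j ((left j).seq (right k)))

theorem Triple.move {j k : ℕ} (hjk : j ≠ k)
    (h : ∀ st, (∀ i, st i ≤ w.length) → Pre st → Post (update (update st k (st j)) j 0)) :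
    Triple w Pre (move j k) (w.length * 5 + 2) Post := by
  intro st hst hP
  obtain ⟨st', n, hn, hex, h0, h1, hst'⟩ := ((Triple.zero (w := w) (r := k) (Pre := fun s => s = st)
      (Post := fun st' => st' j = st j ∧ st' k + st j = st j ∧ ∀ i, i ≠ j → i ≠ k → st' i = st i)
      (by
        rintro _ _ rfl
        refine ⟨by simp [hjk], by simp, fun i _ hi => by simp [hi]⟩)).seq
    (Triple.loop (t := .pos) (r := j) (c := (HeadProgram.left j).seq (.right k)) (b := 1 + 1)
      (fun x st' => st' j = x ∧ st' k + x = st j ∧ ∀ i, i ≠ j → i ≠ k → st' i = st i) (st j)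
    (fun y st' _ hI => by simp [HeadTest.Holds, hI.1])
    (fun y => (Triple.left (Post := fun st' => st' j = y ∧ st' k + (y + 1) = st j ∧
        ∀ i, i ≠ j → i ≠ k → st' i = st i) fun st' _ hI =>
        ⟨by simp [hI.1], by simp [hjk.symm, hI.2.1],
          fun i hi hi' => by simp [hi, hI.2.2 i hi hi']⟩).seq
      (Triple.right fun st' _ hI =>
        ⟨by simp [hjk, hI.1], by have := hst j; simp; omega,
          fun i hi hi' => by simp [hi', hI.2.2 i hi hi']⟩)))) st hst rfl
  refine ⟨st', n, hn.trans ?_, hex, ?_⟩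
  · have := Nat.mul_le_mul_right 3 (hst j)
    omega
  · convert h st hst hP using 1
    funext i
    by_cases hi : i = j
    · subst hi; simpa using h0
    · by_cases hi' : i = k
      · subst hi'; simpa [hi] using h1
      · simp [hi, hi', hst' i hi hi']

/-- Set the head `k` to the position of the head `j`, using the head `l` as scratch. -/
def copy (j k l : ℕ) : HeadProgram :=
  ((zero k).seq (zero l)).seq
    ((loop .pos j ((left j).seq ((right k).seq (right l)))).seq (move l j))

theorem Triple.copy {j k l : ℕ} (hjk : j ≠ k) (hjl : j ≠ l) (hkl : k ≠ l)
    (h : ∀ st, (∀ i, st i ≤ w.length) → Pre st → Post (update (update st k (st j)) l 0)) :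
    Triple w Pre (copy j k l) (w.length * 13 + 5) Post := by
  intro st hst hP
  have h1 : Triple w (fun s => s = st) ((HeadProgram.zero k).seq (HeadProgram.zero l))
      ((w.length * 2 + 1) + (w.length * 2 + 1))
      (fun st' => st' j = st j ∧ st' k + st j = st j ∧ st' l + st j = st j ∧
        ∀ i, i ≠ j → i ≠ k → i ≠ l → st' i = st i) :=
    (Triple.zero (Post := fun st' => st' = update st k 0) (by rintro _ _ rfl; rfl)).seq
      (Triple.zero (by
        rintro _ _ rfl
        exact ⟨by simp [hjk, hjl], by simp [hkl], by simp,
          fun i _ hi hi' => by simp [hi, hi']⟩))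
  have h2 : Triple w (fun st' => st' j = st j ∧ st' k + st j = st j ∧ st' l + st j = st j ∧
        ∀ i, i ≠ j → i ≠ k → i ≠ l → st' i = st i)
      (HeadProgram.loop .pos j ((HeadProgram.left j).seq ((HeadProgram.right k).seq (.right l))))
      (st j * (1 + (1 + 1) + 1) + 1)
      (fun st' => st' j = 0 ∧ st' k + 0 = st j ∧ st' l + 0 = st j ∧
        ∀ i, i ≠ j → i ≠ k → i ≠ l → st' i = st i) :=
    Triple.loop (fun x st' => st' j = x ∧ st' k + x = st j ∧ st' l + x = st j ∧
        ∀ i, i ≠ j → i ≠ k → i ≠ l → st' i = st i) (st j)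
      (fun y st' _ hI => by simp [HeadTest.Holds, hI.1])
      (fun y => (Triple.left (Post := fun st' => st' j = y ∧ st' k + (y + 1) = st j ∧
          st' l + (y + 1) = st j ∧ ∀ i, i ≠ j → i ≠ k → i ≠ l → st' i = st i) fun st' _ hI =>
          ⟨by simp [hI.1], by simp [hjk.symm, hI.2.1], by simp [hjl.symm, hI.2.2.1],
            fun i hi hi' hi'' => by simp [hi, hI.2.2.2 i hi hi' hi'']⟩).seq
        ((Triple.right (Post := fun st' => st' j = y ∧ st' k + y = st j ∧
          st' l + (y + 1) = st j ∧ ∀ i, i ≠ j → i ≠ k → i ≠ l → st' i = st i) fun st' _ hI =>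
          ⟨by simp [hjk, hI.1], by have := hst j; simp; omega, by simp [hkl.symm, hI.2.2.1],
            fun i hi hi' hi'' => by simp [hi', hI.2.2.2 i hi hi' hi'']⟩).seq
        (Triple.right fun st' _ hI =>
          ⟨by simp [hjl, hI.1], by simp [hkl, hI.2.1], by have := hst j; simp; omega,
            fun i hi hi' hi'' => by simp [hi'', hI.2.2.2 i hi hi' hi'']⟩)))
  obtain ⟨st', n, hn, hex, hst'⟩ := (h1.seq (h2.seq (Triple.move (Ne.symm hjl)
    (Post := fun st' => st' = update (update st k (st j)) l 0) (by
      rintro s _ ⟨hj, hk, hl, hs⟩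
      funext i
      by_cases hil : i = l
      · simp [hil]
      · by_cases hij : i = j
        · subst hij; simpa [hil, hjk] using hl
        · by_cases hik : i = k
          · subst hik; simpa [hil, hij] using hk
          · simp [hil, hij, hik, hs i hij hik hil])))) st hst rfl
  refine ⟨st', n, hn.trans ?_, hex, ?_⟩
  · have := Nat.mul_le_mul_right 4 (hst j)
    omega
  · rw [hst']
    exact h st hst hP

end HeadProgram

/-- A type whose elements consist of a nonempty input word `word a` and of values `v a`, one for
each `v ∈ vars`. -/
class WordContext (α : Type) where
  word : α → List Bool
  word_ne_nil : ∀ a, word a ≠ []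
  vars : Set (α → ℕ)

/-- The context `α` with one more variable. -/
instance {α : Type} [WordContext α] : WordContext (α × ℕ) where
  word x := WordContext.word x.1
  word_ne_nil x := WordContext.word_ne_nil x.1
  vars := insert Prod.snd ((fun v x => v x.1) '' WordContext.vars)

section HeadComputable

open HeadProgram WordContext
open Function (update)

variable {α : Type} [WordContext α]

/-- The length of the input word, the largest number that a head position can represent. -/
def wordLength (a : α) : ℕ := (word a).length

/-- The values of the variables can be represented by head positions. -/
def ValidContext (a : α) : Prop := ∀ v ∈ vars (α := α), v a ≤ wordLength a

/-- The relation `P` says how elements of the context are stored in the heads below `m`: each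
variable is the position of one of these heads. -/
structure HeadFrame (m : ℕ) (P : α → (ℕ → ℕ) → Prop) : Prop where
  congr : ∀ a st st', (∀ i < m, st' i = st i) → P a st → P a st'
  vars : ∀ v ∈ vars (α := α), ∃ j < m, ∀ a st, P a st → st j = v a

/-- A function on a context is computable by head programs in polynomial time if, for every way
to store the elements of the context in the heads below `m`, a head program puts the value on the
head `m`, without changing the heads below `m`. The way of storing is arbitrary so that a program
can be used inside another one, where further heads are occupied. -/
def HeadComputable (f : α → ℕ) : Prop :=
  (∀ a, ValidContext a → f a ≤ wordLength a) ∧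
  ∀ (m : ℕ) (P : α → (ℕ → ℕ) → Prop), HeadFrame m P →
    ∃ (c : HeadProgram) (p : Polynomial ℕ), ∀ a s, P a s →
      Triple (word a) (fun st => ∀ i < m, st i = s i) c (p.eval (wordLength a))
        (fun st => st m = f a ∧ ∀ i < m, st i = s i)

/-- A predicate on a context is decidable by head programs in polynomial time; only contexts whose
variables fit into head positions matter. -/
def HeadDecidable (φ : α → Prop) : Prop :=
  ∃ f : α → ℕ, HeadComputable f ∧ ∀ a, ValidContext a → (f a ≠ 0 ↔ φ a)

theorem wordLength_pos (a : α) : 0 < wordLength a := List.length_pos_iff.2 (word_ne_nil a)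

theorem validContext_prod {x : α × ℕ} :
    ValidContext x ↔ ValidContext x.1 ∧ x.2 ≤ wordLength x.1 := by
  simp only [ValidContext, vars, Set.forall_mem_insert, Set.forall_mem_image]
  exact and_comm

theorem HeadFrame.mono {m m' : ℕ} {P : α → (ℕ → ℕ) → Prop} (h : HeadFrame m P) (hm : m ≤ m') :
    HeadFrame m' P :=
  ⟨fun a st st' hst => h.congr a st st' fun i hi => hst i (hi.trans_le hm),
    fun v hv => (h.vars v hv).imp fun _ hj => ⟨hj.1.trans_le hm, hj.2⟩⟩

theorem HeadFrame.fst {m : ℕ} {P : α × ℕ → (ℕ → ℕ) → Prop} (h : HeadFrame m P) :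
    HeadFrame m fun a st => ∃ x, P (a, x) st := by
  refine ⟨fun a st st' hst ⟨x, hx⟩ => ⟨x, h.congr _ st st' hst hx⟩, fun v hv => ?_⟩
  obtain ⟨j, hj, hjv⟩ := h.vars (fun x => v x.1) (Or.inr ⟨v, hv, rfl⟩)
  exact ⟨j, hj, fun a st ⟨x, hx⟩ => hjv _ st hx⟩

theorem HeadFrame.prod {m m' j : ℕ} {P : α → (ℕ → ℕ) → Prop} (h : HeadFrame m P) (hm : m ≤ m')
    (hj : j < m') : HeadFrame m' fun (x : α × ℕ) st => P x.1 st ∧ st j = x.2 := by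
  refine ⟨fun a st st' hst hx => ⟨(h.mono hm).congr _ st st' hst hx.1, (hst j hj).trans hx.2⟩, ?_⟩
  rintro v (rfl | ⟨v, hv, rfl⟩)
  · exact ⟨j, hj, fun _ _ hx => hx.2⟩
  · obtain ⟨i, hi, hiv⟩ := h.vars v hv
    exact ⟨i, hi.trans_le hm, fun _ _ hx => hiv _ _ hx.1⟩

theorem HeadFrame.validContext {m : ℕ} {P : α → (ℕ → ℕ) → Prop} (h : HeadFrame m P) {a : α}
    {s st : ℕ → ℕ} (hs : P a s) (hst : ∀ i, st i ≤ wordLength a) (hagree : ∀ i < m, st i = s i) :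
    ValidContext a := by
  intro v hv
  obtain ⟨j, hj, hjv⟩ := h.vars v hv
  rw [← hjv a s hs, ← hagree j hj]
  exact hst j

namespace HeadComputable

theorem congr {f g : α → ℕ} (hf : HeadComputable f) (h : ∀ a, ValidContext a → f a = g a) :
    HeadComputable g := by
  refine ⟨fun a ha => h a ha ▸ hf.1 a ha, fun m P hP => ?_⟩
  obtain ⟨c, p, hc⟩ := hf.2 m P hP
  refine ⟨c, p, fun a s hs st hst hpre => ?_⟩
  rw [← h a (hP.validContext hs hst hpre)]
  exact hc a s hs st hst hpre

theorem fst {f : α → ℕ} (hf : HeadComputable f) : HeadComputable fun x : α × ℕ => f x.1 := by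
  refine ⟨fun x hx => hf.1 x.1 (validContext_prod.1 hx).1, fun m P hP => ?_⟩
  obtain ⟨c, p, hc⟩ := hf.2 m _ hP.fst
  exact ⟨c, p, fun x s hs => hc x.1 s ⟨x.2, hs⟩⟩

theorem snd : HeadComputable fun x : α × ℕ => x.2 := by
  refine ⟨fun x hx => (validContext_prod.1 hx).2, fun m P hP => ?_⟩
  obtain ⟨j, hj, hjv⟩ := hP.vars Prod.snd (Or.inl rfl)
  refine ⟨copy j m (m + 1), Polynomial.X * 13 + 5, fun x s hs => ?_⟩
  refine (Triple.copy (by omega) (by omega) (by omega) fun st _ hst => ?_).mono (fun _ _ h => h)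
    (by simp; rfl) fun _ _ h => h
  refine ⟨?_, fun i hi => ?_⟩
  · simpa [hst j hj] using hjv x s hs
  · rw [Function.update_of_ne (by omega), Function.update_of_ne (by omega), hst i hi]

theorem const_zero : HeadComputable fun _ : α => 0 := by
  refine ⟨fun _ _ => Nat.zero_le _, fun m P hP => ⟨zero m, Polynomial.X * 2 + 1, fun x s hs => ?_⟩⟩
  refine (Triple.zero fun st _ hst => ?_).mono (fun _ _ h => h) (by simp; rfl) fun _ _ h => h
  exact ⟨by simp, fun i hi => by rw [Function.update_of_ne (by omega), hst i hi]⟩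

theorem length : HeadComputable (wordLength : α → ℕ) := by
  refine ⟨fun _ _ => le_rfl, fun m P hP =>
    ⟨(zero m).seq (loop .inside m (right m)),
      (Polynomial.X * 2 + 1) + (Polynomial.X * (1 + 1) + 1), fun x s hs => ?_⟩⟩
  have h1 : Triple (word x) (fun st => ∀ i < m, st i = s i) (zero m) _
      (fun st => st m + wordLength x = wordLength x ∧ ∀ i < m, st i = s i) :=
    Triple.zero fun st _ hst =>
      ⟨by simp, fun i hi => by rw [Function.update_of_ne (by omega), hst i hi]⟩
  refine (h1.seq (Triple.loop (t := .inside) (r := m) (c := .right m) (b := 1)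
    (fun y st => st m + y = wordLength x ∧ ∀ i < m, st i = s i) (wordLength x)
    (fun y st _ hI => ?_) (fun y => Triple.right fun st _ hI => ⟨?_, fun i hi => ?_⟩))).mono
    (fun _ _ h => h) ?_ fun _ _ h => h
  · simp only [HeadTest.Holds]
    have := hI.1
    unfold wordLength at this
    omega
  · have := hI.1
    unfold wordLength at this ⊢
    simp only [Function.update_self]
    omega
  · rw [Function.update_of_ne (by omega), hI.2 i hi]
  · simp [wordLength]

theorem succ {f : α → ℕ} (hf : HeadComputable f) :
    HeadComputable fun a => min (f a + 1) (wordLength a) := by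
  refine ⟨fun _ _ => min_le_right _ _, fun m P hP => ?_⟩
  obtain ⟨c, p, hc⟩ := hf.2 m P hP
  refine ⟨c.seq (right m), p + 1, fun a s hs => ?_⟩
  refine ((hc a s hs).seq (Triple.right fun st _ hst => ⟨?_, fun i hi => ?_⟩)).mono
    (fun _ _ h => h) (by simp) fun _ _ h => h
  · simp [hst.1, wordLength]
  · rw [Function.update_of_ne (by omega), hst.2 i hi]

theorem pred {f : α → ℕ} (hf : HeadComputable f) : HeadComputable fun a => f a - 1 := by
  refine ⟨fun a ha => (Nat.sub_le _ _).trans (hf.1 a ha), fun m P hP => ?_⟩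
  obtain ⟨c, p, hc⟩ := hf.2 m P hP
  refine ⟨c.seq (left m), p + 1, fun a s hs => ?_⟩
  refine ((hc a s hs).seq (Triple.left fun st _ hst => ⟨?_, fun i hi => ?_⟩)).mono
    (fun _ _ h => h) (by simp) fun _ _ h => h
  · simp [hst.1]
  · rw [Function.update_of_ne (by omega), hst.2 i hi]

/-- Branching on a test of the head at a computed position. -/
theorem ite_holds {f g h : α → ℕ} (t : HeadTest) (hf : HeadComputable f) (hg : HeadComputable g)
    (hh : HeadComputable h) [∀ a, Decidable (t.Holds (word a) (f a))] :
    HeadComputable fun a => if t.Holds (word a) (f a) then g a else h a := by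
  refine ⟨fun a ha => ?_, fun m P hP => ?_⟩
  · dsimp only
    split_ifs
    exacts [hg.1 a ha, hh.1 a ha]
  obtain ⟨c, p, hc⟩ := hf.2 m P hP
  obtain ⟨c₁, p₁, hc₁⟩ := hg.2 m P hP
  obtain ⟨c₂, p₂, hc₂⟩ := hh.2 m P hP
  refine ⟨c.seq (ite t m c₁ c₂), p + (1 + p₁ + p₂), fun a s hs => ?_⟩
  refine ((hc a s hs).seq (Triple.ite (t := t) (r := m) ?_ ?_)).mono (fun _ _ h => h)
    (by simp; rfl) fun _ _ h => h
  · intro st hst ⟨⟨hm, hpre⟩, ht⟩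
    rw [hm] at ht
    simpa only [if_pos ht] using hc₁ a s hs st hst hpre
  · intro st hst ⟨⟨hm, hpre⟩, ht⟩
    rw [hm] at ht
    simpa only [if_neg ht] using hc₂ a s hs st hst hpre

/-- Primitive recursion. The number of rounds is itself a head position, so at most the length of the
word; this is why the time stays polynomial. -/
theorem natRec {cnt init : α → ℕ} {step : α → ℕ → ℕ → ℕ} (hcnt : HeadComputable cnt)
    (hinit : HeadComputable init)
    (hstep : HeadComputable fun x : (α × ℕ) × ℕ => step x.1.1 x.1.2 x.2) :
    HeadComputable fun a => Nat.rec (init a) (step a) (cnt a) := by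
  have hbound : ∀ a, ValidContext a → ∀ n ≤ cnt a,
      (Nat.rec (init a) (step a) n : ℕ) ≤ wordLength a := by
    intro a ha n
    induction n with
    | zero => exact fun _ => hinit.1 a ha
    | succ n ih =>
      intro hn
      refine hstep.1 ((a, n), _) (validContext_prod.2 ⟨validContext_prod.2 ⟨ha, ?_⟩, ?_⟩)
      · have := hcnt.1 a ha
        dsimp only
        omega
      · exact ih (by omega)
  refine ⟨fun a ha => hbound a ha _ le_rfl, fun m P hP => ?_⟩
  -- During the loop, the head `m` holds the value, `m + 1` the number of rounds left, `m + 2` the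
  -- number of rounds that are done, and `m + 3` the next value.
  obtain ⟨c₁, p₁, hc₁⟩ := hinit.2 m P hP
  obtain ⟨c₂, p₂, hc₂⟩ := hcnt.2 (m + 1) P (hP.mono (by omega))
  obtain ⟨c₃, p₃, hc₃⟩ := hstep.2 (m + 3) _
    ((hP.prod (j := m + 2) (m' := m + 3) (by omega) (by omega)).prod (j := m) (m' := m + 3)
      le_rfl (by omega))
  refine ⟨(c₁.seq (c₂.seq (zero (m + 2)))).seq (loop .pos (m + 1)
    ((left (m + 1)).seq (c₃.seq ((move (m + 3) m).seq (right (m + 2)))))),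
    (p₁ + (p₂ + (Polynomial.X * 2 + 1))) +
      (Polynomial.X * ((1 + (p₃ + ((Polynomial.X * 5 + 2) + 1))) + 1) + 1),
    fun a s hs st hst hpre => ?_⟩
  have hvalid := hP.validContext hs hst hpre
  have hcnt_le := hcnt.1 a hvalid
  obtain ⟨F, hF0, hFs, hF⟩ : ∃ F : ℕ → ℕ, F 0 = init a ∧ (∀ n, F (n + 1) = step a n (F n)) ∧
      F (cnt a) = Nat.rec (init a) (step a) (cnt a) :=
    ⟨fun n => Nat.rec (init a) (step a) n, rfl, fun _ => rfl, rfl⟩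
  have hstart : Triple (word a) (fun st => ∀ i < m, st i = s i) (c₁.seq (c₂.seq (zero (m + 2))))
      (p₁.eval (wordLength a) + (p₂.eval (wordLength a) +
        ((word a).length * 2 + 1)))
      (fun st => st (m + 1) = cnt a ∧ st (m + 2) + cnt a = cnt a ∧ st m = F (st (m + 2)) ∧
        ∀ i < m, st i = s i) := by
    refine (hc₁ a s hs).seq (Triple.seq (Mid := fun st => st (m + 1) = cnt a ∧ st m = F 0 ∧
      ∀ i < m, st i = s i) ?_ ?_)
    · intro st hst ⟨hm, hpre⟩
      obtain ⟨st', n, hn, hex, h1, h2⟩ := hc₂ a st (hP.congr a s st hpre hs) st hst fun _ _ => rfl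
      exact ⟨st', n, hn, hex, h1, by rw [h2 m (by omega), hm, hF0],
        fun i hi => by rw [h2 i (by omega), hpre i hi]⟩
    · refine Triple.zero fun st _ ⟨h1, h2, h3⟩ => ⟨?_, ?_, ?_, fun i hi => ?_⟩
      · simp [h1]
      · simp
      · simp [h2]
      · rw [Function.update_of_ne (by omega), h3 i hi]
  have hloop := Triple.loop (w := word a) (t := .pos) (r := m + 1)
    (c := (left (m + 1)).seq (c₃.seq ((move (m + 3) m).seq (right (m + 2)))))
    (b := 1 + (p₃.eval (wordLength a) + (((word a).length * 5 + 2) + 1)))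
    (fun y st => st (m + 1) = y ∧ st (m + 2) + y = cnt a ∧ st m = F (st (m + 2)) ∧
      ∀ i < m, st i = s i) (cnt a)
    (fun y st _ hI => by simp [HeadTest.Holds, hI.1])
    (fun y => by
      refine Triple.seq (Mid := fun st => st (m + 1) = y ∧ st (m + 2) + (y + 1) = cnt a ∧
        st m = F (st (m + 2)) ∧ ∀ i < m, st i = s i) ?_ (Triple.seq (Mid := fun st =>
        st (m + 1) = y ∧ st (m + 2) + (y + 1) = cnt a ∧
        st (m + 3) = F (st (m + 2) + 1) ∧ ∀ i < m, st i = s i) ?_ (Triple.seq (Mid := fun st =>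
        st (m + 1) = y ∧ st (m + 2) + (y + 1) = cnt a ∧
        st m = F (st (m + 2) + 1) ∧ ∀ i < m, st i = s i) ?_ ?_))
      · refine Triple.left fun st _ ⟨h1, h2, h3, h4⟩ => ⟨?_, ?_, ?_, fun i hi => ?_⟩
        · simp [h1]
        · simp [h2]
        · simp [h3]
        · rw [Function.update_of_ne (by omega), h4 i hi]
      · intro st hst ⟨h1, h2, h3, h4⟩
        obtain ⟨st', n, hn, hex, h5, h6⟩ := hc₃ ((a, st (m + 2)), st m) st
          ⟨⟨hP.congr a s st h4 hs, rfl⟩, rfl⟩ st hst fun _ _ => rfl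
        refine ⟨st', n, hn, hex, ?_, ?_, ?_, fun i hi => ?_⟩
        · rw [h6 _ (by omega), h1]
        · rw [h6 _ (by omega), h2]
        · rw [h5, h6 _ (by omega), hFs, h3]
        · rw [h6 i (by omega), h4 i hi]
      · refine Triple.move (by omega) fun st _ ⟨h1, h2, h3, h4⟩ => ⟨?_, ?_, ?_, fun i hi => ?_⟩
        · simp [h1]
        · simp [h2]
        · simp [h3]
        · rw [Function.update_of_ne (by omega), Function.update_of_ne (by omega), h4 i hi]
      · refine Triple.right fun st _ ⟨h1, h2, h3, h4⟩ => ?_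
        have hlt : st (m + 2) + 1 ≤ (word a).length := by
          have : cnt a ≤ (word a).length := hcnt_le
          omega
        rw [min_eq_left hlt]
        refine ⟨?_, ?_, ?_, fun i hi => ?_⟩
        · simp [h1]
        · simp only [Function.update_self]
          omega
        · simp [h3]
        · rw [Function.update_of_ne (by omega), h4 i hi])
  obtain ⟨st', n, hn, hex, h1, h2, h3, h4⟩ := hstart.seq hloop st hst hpre
  refine ⟨st', n, hn.trans ?_, hex, ?_, h4⟩
  · simp only [Polynomial.eval_add, Polynomial.eval_mul, Polynomial.eval_ofNat, Polynomial.eval_X,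
      Polynomial.eval_one]
    gcongr
    all_goals rfl
  · rw [h3]
    exact (congrArg F h2).trans hF

end HeadComputable

end HeadComputable

/-! ### Arithmetic and bounded quantifiers -/

section

open HeadProgram WordContext

variable {α : Type} [WordContext α]

namespace HeadComputable

theorem bit {f : α → ℕ} (hf : HeadComputable f) :
    HeadDecidable fun a => (word a)[f a]? = some true := by
  classical
  refine ⟨_, ite_holds .bit hf (const_zero.succ) const_zero, fun a _ => ?_⟩
  have := wordLength_pos a
  simp only [HeadTest.Holds]
  split_ifs with h
  · have : min (0 + 1) (wordLength a) ≠ 0 := by omega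
    simpa [h] using this
  · simp [h]

theorem ite {φ : α → Prop} [∀ a, Decidable (φ a)] {f g : α → ℕ} (hφ : HeadDecidable φ)
    (hf : HeadComputable f) (hg : HeadComputable g) :
    HeadComputable fun a => if φ a then f a else g a := by
  classical
  obtain ⟨h, hh, hhφ⟩ := hφ
  refine (ite_holds .pos hh hf hg).congr fun a ha => ?_
  simp only [HeadTest.Holds, hhφ a ha]

theorem const_one : HeadComputable fun _ : α => 1 :=
  const_zero.succ.congr fun a _ => by
    have := wordLength_pos a
    omega

/-- Addition, cut off at the length of the word. -/
theorem add {f g : α → ℕ} (hf : HeadComputable f) (hg : HeadComputable g) :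
    HeadComputable fun a => min (f a + g a) (wordLength a) := by
  refine (natRec (step := fun a _ acc => min (acc + 1) (wordLength a)) hg hf
    snd.succ).congr fun a ha => ?_
  have := hf.1 a ha
  induction g a with
  | zero => simpa using this
  | succ n ih =>
    dsimp only at ih ⊢
    omega

/-- Multiplication, cut off at the length of the word. -/
theorem mul {f g : α → ℕ} (hf : HeadComputable f) (hg : HeadComputable g) :
    HeadComputable fun a => min (f a * g a) (wordLength a) := by
  refine (natRec (step := fun a _ acc => min (acc + f a) (wordLength a)) hg const_zero
    (snd.add hf.fst.fst)).congr fun a _ => ?_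
  induction g a with
  | zero => simp
  | succ n ih =>
    rw [Nat.mul_succ]
    dsimp only at ih ⊢
    omega

theorem sub {f g : α → ℕ} (hf : HeadComputable f) (hg : HeadComputable g) :
    HeadComputable fun a => f a - g a := by
  refine (natRec (step := fun _ _ acc => acc - 1) hg hf snd.pred).congr fun a _ => ?_
  induction g a with
  | zero => simp
  | succ n ih =>
    dsimp only at ih ⊢
    omega

theorem lt {f g : α → ℕ} (hf : HeadComputable f) (hg : HeadComputable g) :
    HeadDecidable fun a => f a < g a :=
  ⟨_, hg.sub hf, fun a _ => by omega⟩

end HeadComputable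

namespace HeadDecidable

theorem congr {φ ψ : α → Prop} (hφ : HeadDecidable φ) (h : ∀ a, ValidContext a → (φ a ↔ ψ a)) :
    HeadDecidable ψ := by
  obtain ⟨f, hf, hfφ⟩ := hφ
  exact ⟨f, hf, fun a ha => (hfφ a ha).trans (h a ha)⟩

theorem not {φ : α → Prop} (hφ : HeadDecidable φ) : HeadDecidable fun a => ¬ φ a := by
  classical
  exact ⟨_, .ite hφ .const_zero .const_one, fun a _ => by by_cases h : φ a <;> simp [h]⟩

theorem and {φ ψ : α → Prop} (hφ : HeadDecidable φ) (hψ : HeadDecidable ψ) :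
    HeadDecidable fun a => φ a ∧ ψ a := by
  classical
  obtain ⟨f, hf, hfψ⟩ := hψ
  refine ⟨_, .ite hφ hf .const_zero, fun a ha => ?_⟩
  by_cases h : φ a <;> simp [h, hfψ a ha]

theorem or {φ ψ : α → Prop} (hφ : HeadDecidable φ) (hψ : HeadDecidable ψ) :
    HeadDecidable fun a => φ a ∨ ψ a :=
  (hφ.not.and hψ.not).not.congr fun a _ => by tauto

theorem exists_lt {N : α → ℕ} {φ : α → ℕ → Prop} (hN : HeadComputable N)
    (hφ : HeadDecidable fun x : α × ℕ => φ x.1 x.2) :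
    HeadDecidable fun a => ∃ i < N a, φ a i := by
  classical
  refine ⟨_, .natRec (step := fun a i acc => if φ a i then 1 else acc) hN .const_zero
    (.ite (φ := fun x : (α × ℕ) × ℕ => φ x.1.1 x.1.2) ?_ .const_one .snd), fun a _ => ?_⟩
  · obtain ⟨f, hf, hfφ⟩ := hφ
    exact ⟨_, hf.fst, fun x hx => hfφ x.1 (validContext_prod.1 hx).1⟩
  · dsimp only
    generalize N a = n
    induction n with
    | zero => simp
    | succ n ih =>
      by_cases h : φ a n
      · simp only [h, if_true, ne_eq, one_ne_zero, not_false_eq_true, true_iff]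
        exact ⟨n, n.lt_succ_self, h⟩
      · dsimp only
        rw [if_neg h, ih]
        refine exists_congr fun i => ⟨fun hi => ⟨by omega, hi.2⟩, fun hi => ⟨?_, hi.2⟩⟩
        have : i ≠ n := fun e => h (e ▸ hi.2)
        omega

theorem forall_lt {N : α → ℕ} {φ : α → ℕ → Prop} (hN : HeadComputable N)
    (hφ : HeadDecidable fun x : α × ℕ => φ x.1 x.2) :
    HeadDecidable fun a => ∀ i < N a, φ a i :=
  (exists_lt (φ := fun a i => ¬ φ a i) hN hφ.not).not.congr fun a _ => by push Not; rfl

theorem imp {φ ψ : α → Prop} (hφ : HeadDecidable φ) (hψ : HeadDecidable ψ) :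
    HeadDecidable fun a => φ a → ψ a :=
  (hφ.not.or hψ).congr fun a _ => by tauto

end HeadDecidable

namespace HeadComputable

theorem eq {f g : α → ℕ} (hf : HeadComputable f) (hg : HeadComputable g) :
    HeadDecidable fun a => f a = g a :=
  ((hf.lt hg).or (hg.lt hf)).not.congr fun a _ => by omega

theorem half {f : α → ℕ} (hf : HeadComputable f) : HeadComputable fun a => f a / 2 := by
  -- After `i` rounds the value is `i / 2`, which increases in the next round if `i` is odd.
  refine (natRec (step := fun a i acc => if min (acc + acc) (wordLength a) = i then acc else
    min (acc + 1) (wordLength a)) hf const_zero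
    (ite ((snd.add snd).eq snd.fst) snd snd.succ)).congr fun a ha => ?_
  have := hf.1 a ha
  generalize f a = n at this ⊢
  induction n with
  | zero => simp
  | succ n ih =>
    have ih := ih (by omega)
    dsimp only at ih ⊢
    rw [ih]
    split_ifs <;> omega

theorem odd {f : α → ℕ} (hf : HeadComputable f) : HeadDecidable fun a => f a % 2 = 1 :=
  ((hf.half.add hf.half).eq hf).not.congr fun a ha => by
    have := hf.1 a ha
    omega

/-- Starting from the position `f a`, move right over letters `true`. -/
theorem scan {f : α → ℕ} (hf : HeadComputable f) : HeadComputable fun a =>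
    (Nat.rec (f a) (fun _ acc => if (word a)[acc]? = some true then
      min (acc + 1) (wordLength a) else acc) (wordLength a) : ℕ) :=
  natRec (step := fun a _ acc => if (word a)[acc]? = some true then
      min (acc + 1) (wordLength a) else acc) length hf (ite snd.bit snd.succ snd)

end HeadComputable

/-- A predicate on words that is decidable by head programs in polynomial time is decidable by a
multi-stack Turing machine in polynomial time. -/
theorem HeadDecidable.polyTime {β : Type} (ι : β → α)
    (hvars : vars (α := α) = ∅) {φ : α → Prop} (hφ : HeadDecidable φ) (f : β → Bool)
    (hf : ∀ b, f b = true ↔ φ (ι b)) :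
    Nonempty (Turing.TM2ComputableInPolyTime (fun b => word (ι b)) Computability.encodeBool f) := by
  obtain ⟨g, hg, hgφ⟩ := hφ
  obtain ⟨c, p, hc⟩ := hg.2 0 (fun _ _ => True) ⟨fun _ _ _ _ _ => trivial, by simp [hvars]⟩
  refine HeadProgram.polyTime _ f c p fun b => ?_
  obtain ⟨st, n, hn, hex, h0, -⟩ := hc (ι b) (fun _ => 0) trivial (fun _ => (word (ι b)).length)
    (fun _ => le_rfl) (by simp)
  exact ⟨st, n, hex, hn, by rw [hf, h0, hgφ _ (by simp [ValidContext, hvars])]⟩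

end

/-! ### Reading a gadget from its description -/

namespace TunnelGadget

/-- A gadget is a context without variables; its description is the input word. -/
instance : WordContext TunnelGadget where
  word := encode
  word_ne_nil G := by simp [encode]
  vars := ∅

/-- `TunnelGadget.trans` for natural numbers; the direction `d` is `0` or `1`. -/
def NatTrans (G : TunnelGadget) (s t d s' : ℕ) : Prop :=
  d < 2 ∧ ∃ (hs : s < G.numStates) (ht : t < G.numTunnels) (hs' : s' < G.numStates),
    G.trans ⟨s, hs⟩ (⟨t, ht⟩, decide (d = 1)) ⟨s', hs'⟩ = true

/-- `TunnelGadget.CanTraverse` for natural numbers. -/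
def NatCanTraverse (G : TunnelGadget) (s t d : ℕ) : Prop :=
  ∃ s' < G.numStates, G.NatTrans s t d s'

/-- `TunnelGadget.IsOpen` for natural numbers. -/
def NatIsOpen (G : TunnelGadget) (s t : ℕ) : Prop :=
  G.NatCanTraverse s t 0 ∨ G.NatCanTraverse s t 1

variable {G : TunnelGadget}

theorem natTrans_coe {s s' : Fin G.numStates} {t : Fin G.numTunnels} {d : Bool} :
    G.NatTrans s t d.toNat s' ↔ G.trans s (t, d) s' = true := by
  cases d <;> simp [NatTrans]

theorem natCanTraverse_coe {s : Fin G.numStates} {t : Fin G.numTunnels} {d : Bool} :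
    G.NatCanTraverse s t d.toNat ↔ G.CanTraverse s (t, d) := by
  simp only [NatCanTraverse, CanTraverse, ← natTrans_coe, Fin.exists_iff, exists_prop]

theorem natIsOpen_coe {s : Fin G.numStates} {t : Fin G.numTunnels} :
    G.NatIsOpen s t ↔ G.IsOpen s t := by
  rw [IsOpen, Bool.exists_bool]
  exact or_congr (natCanTraverse_coe (d := false)) (natCanTraverse_coe (d := true))

theorem _root_.List.getElem?_flatMap_of_length_eq {β γ : Type*} (l : List β) (f : β → List γ)
    {m : ℕ} (hf : ∀ x, (f x).length = m) {i j : ℕ} (hi : i < l.length) (hj : j < m) :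
    (l.flatMap f)[i * m + j]? = (f l[i])[j]? := by
  induction l generalizing i with
  | nil => simp at hi
  | cons x l ih =>
    rw [List.flatMap_cons]
    rcases i with _ | i
    · rw [Nat.zero_mul, Nat.zero_add, List.getElem?_append_left (by rw [hf]; exact hj)]
      rfl
    · have e : (i + 1) * m + j = m + (i * m + j) := by ring
      rw [List.getElem?_append_right (by rw [hf, e]; omega), hf, e, Nat.add_sub_cancel_left,
        ih (by simpa using hi)]
      rfl

/-- Where the description of a gadget shows the entry `trans s (t, d) s'` of the table. -/
theorem getElem?_encode (s s' : Fin G.numStates) (t : Fin G.numTunnels) (d : Bool) :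
    G.encode[((s * G.numTunnels + t) * 2 + d.toNat) * G.numStates + s' +
      (G.numStates + 1 + G.numTunnels + 1)]? = some (G.trans s (t, d) s') := by
  rw [encode, List.getElem?_append_right (by simp; omega)]
  have e : ((s * G.numTunnels + t) * 2 + d.toNat) * G.numStates + s' +
        (G.numStates + 1 + G.numTunnels + 1) -
      (List.replicate G.numStates true ++ [false] ++ List.replicate G.numTunnels true ++
        [false]).length =
      s * (G.numTunnels * (2 * G.numStates)) + (t * (2 * G.numStates) +
        (d.toNat * G.numStates + s')) := by
    simp only [List.length_append, List.length_replicate, List.length_singleton]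
    rw [Nat.add_sub_cancel]
    ring
  have hd : d.toNat * G.numStates + s' < 2 * G.numStates := by
    have := s'.2
    have := Nat.mul_le_mul_right G.numStates (Nat.le_of_lt_succ d.toNat_lt)
    omega
  have ht : t * (2 * G.numStates) + (d.toNat * G.numStates + s') <
      G.numTunnels * (2 * G.numStates) := by
    have := Nat.mul_le_mul_right (2 * G.numStates) (Nat.succ_le_of_lt t.2)
    rw [Nat.succ_mul] at this
    omega
  rw [e, List.getElem?_flatMap_of_length_eq (m := G.numTunnels * (2 * G.numStates)) _ _
    (fun x => by simp [two_mul]) (by simp) ht,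
    List.getElem?_flatMap_of_length_eq (m := 2 * G.numStates) _ _
    (fun x => by simp [two_mul]) (by simp) hd]
  have h := List.getElem?_flatMap_of_length_eq [false, true]
    (fun d => (List.finRange G.numStates).map fun s' => G.trans s (t, d) s')
    (fun x => by simp) (i := d.toNat) d.toNat_lt s'.2
  simp only [List.getElem_finRange]
  refine Eq.trans h ?_
  cases d <;> simp

/-- Counting the letters `true` from a given position on, as a recursion that a head program can
carry out. -/
theorem rec_scan (w u v : List Bool) (n : ℕ) (hw : w = u ++ (List.replicate n true ++ false :: v))
    (j : ℕ) :
    (Nat.rec u.length (fun _ acc => if w[acc]? = some true then min (acc + 1) w.length else acc) j :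
      ℕ) = u.length + min j n := by
  have hlen : w.length = u.length + n + v.length + 1 := by
    simp [hw]; omega
  induction j with
  | zero => simp
  | succ j ih =>
    dsimp only at ih ⊢
    rw [ih]
    have h : w[u.length + min j n]? = some true ↔ j < n := by
      rw [hw, List.getElem?_append_right (by omega), Nat.add_sub_cancel_left]
      by_cases hj : j < n
      · rw [List.getElem?_append_left (by simp; omega)]
        simp [hj]
      · rw [min_eq_right (by omega), List.getElem?_append_right (by simp)]
        simp [hj]
    simp only [h]
    split_ifs <;> omega

theorem length_encode_ge : G.numStates + G.numTunnels + 2 ≤ G.encode.length := by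
  simp [encode]
  omega

end TunnelGadget

/-- A context that contains a gadget, whose description is the input word. -/
class GadgetContext (α : Type) [WordContext α] where
  gadget : α → TunnelGadget
  word_eq : ∀ a : α, WordContext.word a = (gadget a).encode

instance : GadgetContext TunnelGadget := ⟨id, fun _ => rfl⟩

instance {α : Type} [WordContext α] [GadgetContext α] : GadgetContext (α × ℕ) :=
  ⟨fun x => GadgetContext.gadget x.1, fun x => GadgetContext.word_eq x.1⟩

section

open GadgetContext TunnelGadget

variable {α : Type} [WordContext α] [GadgetContext α]

theorem le_wordLength (a : α) :
    (gadget a).numStates + (gadget a).numTunnels + 2 ≤ wordLength a := by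
  rw [wordLength, word_eq]
  exact length_encode_ge

namespace HeadComputable

theorem const_two : HeadComputable fun _ : α => 2 :=
  const_one.succ.congr fun a _ => by
    have := le_wordLength a
    omega

theorem numStates : HeadComputable fun a : α => (gadget a).numStates :=
  const_zero.scan.congr fun a _ => by
    have := le_wordLength a
    refine (rec_scan (WordContext.word a) [] _ (gadget a).numStates
      (by simp [word_eq, encode]; rfl) _).trans ?_
    simp
    omega

/-- The position at which the table of the transition graph starts. -/
theorem tableStart :
    HeadComputable fun a : α => (gadget a).numStates + 1 + (gadget a).numTunnels + 1 :=
  numStates.succ.scan.succ.congr fun a _ => by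
    have := le_wordLength a
    have h := rec_scan (WordContext.word a)
      (List.replicate (gadget a).numStates true ++ [false]) _ (gadget a).numTunnels
      (by simp [word_eq, encode]; rfl) (wordLength a)
    rw [List.length_append, List.length_replicate, List.length_singleton] at h
    rw [min_eq_left (by omega : (gadget a).numStates + 1 ≤ wordLength a)]
    unfold wordLength at *
    rw [h]
    omega

theorem numTunnels : HeadComputable fun a : α => (gadget a).numTunnels :=
  (tableStart.pred.sub numStates.succ).congr fun a _ => by
    have := le_wordLength a
    omega

/-- The position of a table entry, computed with all intermediate results cut off at `L`, is exact
if it is at most `L`. -/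
theorem min_tablePosition {x t d n s' b L : ℕ} (hn : 0 < n)
    (h : ((x + t) * 2 + d) * n + s' + b ≤ L) :
    min (min (min (min (min (min (min x L + t) L + min (min x L + t) L) L + d) L * n) L + s') L + b)
      L = ((x + t) * 2 + d) * n + s' + b := by
  have hle := Nat.le_mul_of_pos_right ((x + t) * 2 + d) hn
  rw [min_eq_left (a := x) (by omega), min_eq_left (a := x + t) (by omega), ← mul_two,
    min_eq_left (a := (x + t) * 2) (by omega), min_eq_left (a := (x + t) * 2 + d) (by omega),
    min_eq_left (a := ((x + t) * 2 + d) * n) (by omega),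
    min_eq_left (a := ((x + t) * 2 + d) * n + s') (by omega), min_eq_left h]

theorem natTrans {s t d s' : α → ℕ} (hs : HeadComputable s) (ht : HeadComputable t)
    (hd : HeadComputable d) (hs' : HeadComputable s') :
    HeadDecidable fun a => (gadget a).NatTrans (s a) (t a) (d a) (s' a) := by
  have hrow := (hs.mul numTunnels).add ht
  have hindex := (((((hrow.add hrow).add hd).mul numStates).add hs').add tableStart).bit
  refine ((((hd.lt const_two).and (hs.lt numStates)).and
    ((ht.lt numTunnels).and (hs'.lt numStates))).and hindex).congr fun a _ => ?_
  rw [word_eq]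
  have hvalue : ∀ (hd : d a < 2) (hs : s a < (gadget a).numStates)
      (ht : t a < (gadget a).numTunnels) (hs' : s' a < (gadget a).numStates),
      (gadget a).encode[((s a * (gadget a).numTunnels + t a) * 2 + d a) *
        (gadget a).numStates + s' a + ((gadget a).numStates + 1 + (gadget a).numTunnels + 1)]? =
        some ((gadget a).trans ⟨s a, hs⟩ (⟨t a, ht⟩, decide (d a = 1)) ⟨s' a, hs'⟩) := by
    intro hd hs ht hs'
    have hd1 : (decide (d a = 1)).toNat = d a := by
      rcases (by omega : d a = 0 ∨ d a = 1) with h | h <;> simp [h]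
    have h := getElem?_encode ⟨s a, hs⟩ ⟨s' a, hs'⟩ ⟨t a, ht⟩ (decide (d a = 1))
    rwa [hd1] at h
  -- The position in the table lies inside the word, so that no intermediate result is cut off.
  have hlt : ∀ (_ : d a < 2) (_ : s a < (gadget a).numStates)
      (_ : t a < (gadget a).numTunnels) (_ : s' a < (gadget a).numStates),
      ((s a * (gadget a).numTunnels + t a) * 2 + d a) *
        (gadget a).numStates + s' a + ((gadget a).numStates + 1 + (gadget a).numTunnels + 1) ≤
        wordLength a := by
    intro hd hs ht hs'
    obtain ⟨hlt, -⟩ := List.getElem?_eq_some_iff.1 (hvalue hd hs ht hs')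
    rw [← word_eq] at hlt
    exact hlt.le
  constructor
  · rintro ⟨⟨⟨hd, hs⟩, ht, hs'⟩, h⟩
    rw [min_tablePosition (by omega) (hlt hd hs ht hs'), hvalue hd hs ht hs'] at h
    exact ⟨hd, hs, ht, hs', Option.some_injective _ h⟩
  · rintro ⟨hd, hs, ht, hs', h⟩
    refine ⟨⟨⟨hd, hs⟩, ht, hs'⟩, ?_⟩
    rw [min_tablePosition (by omega) (hlt hd hs ht hs'), hvalue hd hs ht hs', h]

end HeadComputable

end

/-! ### Deciding the hardness criterion -/

namespace TunnelGadget

open Classical in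
/-- The number of tunnels below `j` that are open in the state `s`. -/
noncomputable def openBelow (G : TunnelGadget) (s j : ℕ) : ℕ := Nat.count (G.NatIsOpen s) j

/-- The direction that the code `c` chooses for the tunnel `u` in the state `s`: the binary digits
of `c` are the directions of the tunnels that are open in `s`, in their order. -/
noncomputable def chosenDirection (G : TunnelGadget) (s c u : ℕ) : ℕ :=
  c / 2 ^ G.openBelow s u % 2

/-- `TunnelGadget.HasDistantOpening` for natural numbers. -/
def NatHasDistantOpening (G : TunnelGadget) : Prop :=
  ∃ s < G.numStates, ∃ s' < G.numStates, ∃ t < G.numTunnels, ∃ d < 2, ∃ u < G.numTunnels, ∃ e < 2,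
    G.NatTrans s t d s' ∧ ¬ u = t ∧ ¬ G.NatCanTraverse s u e ∧ G.NatCanTraverse s' u e

/-- The traversal `(t, d)` and the directions chosen by the code `c` for the other tunnels form a
forced distant closing in the state `s`. A tunnel that cannot be traversed in its chosen direction
is left out of the set of tunnels. -/
def ForcedByCode (G : TunnelGadget) (s t d c : ℕ) : Prop :=
  G.NatCanTraverse s t d ∧ ∀ s' < G.numStates, G.NatTrans s t d s' →
    ∃ u < G.numTunnels, ¬ u = t ∧ G.NatCanTraverse s u (G.chosenDirection s c u) ∧
      ¬ G.NatCanTraverse s' u (G.chosenDirection s c u)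

/-- The criterion that the machine checks. The number of codes for a state, cut off at the length
of the description, is compared with the number of states; if it is larger and there are no
distant openings, then some state has a forced distant closing. Otherwise all codes are tried. -/
def Criterion (G : TunnelGadget) : Prop :=
  G.NatHasDistantOpening ∨
    ((∃ s < G.numStates,
        G.numStates < min (2 ^ G.openBelow s G.numTunnels) (wordLength G)) ∨
      ∃ s < G.numStates, ∃ t < G.numTunnels, ∃ d < 2,
        ∃ c < min (2 ^ G.openBelow s G.numTunnels) (wordLength G), G.ForcedByCode s t d c)

end TunnelGadget

section

open GadgetContext TunnelGadget

variable {α : Type} [WordContext α] [GadgetContext α]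

namespace HeadComputable

theorem natCanTraverse {s t d : α → ℕ} (hs : HeadComputable s) (ht : HeadComputable t)
    (hd : HeadComputable d) :
    HeadDecidable fun a => (gadget a).NatCanTraverse (s a) (t a) (d a) :=
  .exists_lt (φ := fun a s' => (gadget a).NatTrans (s a) (t a) (d a) s') numStates
    (natTrans hs.fst ht.fst hd.fst snd)

theorem natIsOpen {s t : α → ℕ} (hs : HeadComputable s) (ht : HeadComputable t) :
    HeadDecidable fun a => (gadget a).NatIsOpen (s a) (t a) :=
  (natCanTraverse hs ht const_zero).or (natCanTraverse hs ht const_one)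

open Classical in
theorem min_two_pow_openBelow {s : α → ℕ} (hs : HeadComputable s) :
    HeadComputable fun a =>
      min (2 ^ (gadget a).openBelow (s a) (gadget a).numTunnels) (wordLength a) := by
  refine (natRec (step := fun a t acc => if (gadget a).NatIsOpen (s a) t then
    min (acc + acc) (wordLength a) else acc) numTunnels const_one
    (ite (natIsOpen hs.fst.fst snd.fst) (snd.add snd) snd)).congr fun a _ => ?_
  have hL := le_wordLength a
  generalize (gadget a).numTunnels = k
  induction k with
  | zero => simp [openBelow]; omega
  | succ k ih =>
    dsimp only at ih ⊢
    rw [ih, openBelow, openBelow, Nat.count_succ]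
    split_ifs
    · rw [pow_succ]
      omega
    · rfl

open Classical in
theorem chosenDirection {s c u : α → ℕ} (hs : HeadComputable s) (hc : HeadComputable c)
    (hu : HeadComputable u) :
    HeadComputable fun a => (gadget a).chosenDirection (s a) (c a) (u a) := by
  have hdiv : HeadComputable fun a => c a / 2 ^ (gadget a).openBelow (s a) (u a) := by
    refine (natRec (step := fun a t acc => if (gadget a).NatIsOpen (s a) t then acc / 2 else acc)
      hu hc (ite (natIsOpen hs.fst.fst snd.fst) snd.half snd)).congr fun a _ => ?_
    generalize u a = k
    induction k with
    | zero => simp [openBelow]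
    | succ k ih =>
      dsimp only at ih ⊢
      rw [ih, openBelow, openBelow, Nat.count_succ]
      split_ifs
      · rw [Nat.div_div_eq_div_mul, pow_succ]
      · rfl
  refine (ite hdiv.odd const_one const_zero).congr fun a _ => ?_
  unfold TunnelGadget.chosenDirection
  split_ifs <;> omega

theorem natHasDistantOpening : HeadDecidable fun a : α => (gadget a).NatHasDistantOpening := by
  refine .exists_lt numStates (.exists_lt numStates (.exists_lt numTunnels (.exists_lt const_two
    (.exists_lt numTunnels (.exists_lt const_two (.and (natTrans ?s ?t ?d ?s') (.and
      (eq ?u ?t).not (.and (natCanTraverse ?s ?u ?e).not (natCanTraverse ?s' ?u ?e)))))))))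
  exacts [snd.fst.fst.fst.fst.fst, snd.fst.fst.fst, snd.fst.fst, snd.fst.fst.fst.fst, snd.fst, snd]

theorem forcedByCode {s t d c : α → ℕ} (hs : HeadComputable s) (ht : HeadComputable t)
    (hd : HeadComputable d) (hc : HeadComputable c) :
    HeadDecidable fun a => (gadget a).ForcedByCode (s a) (t a) (d a) (c a) := by
  refine (natCanTraverse hs ht hd).and (.forall_lt numStates (.imp
    (natTrans hs.fst ht.fst hd.fst snd) (.exists_lt numTunnels (.and
      (snd.eq ht.fst.fst).not (.and (natCanTraverse hs.fst.fst snd ?_)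
        (natCanTraverse snd.fst snd ?_).not)))))
  all_goals exact chosenDirection hs.fst.fst hc.fst.fst snd

theorem criterion : HeadDecidable Criterion := by
  refine .or natHasDistantOpening (.or (.exists_lt numStates
    (lt numStates (min_two_pow_openBelow snd))) (.exists_lt numStates (.exists_lt numTunnels
      (.exists_lt const_two (.exists_lt (min_two_pow_openBelow snd.fst.fst) (forcedByCode
        snd.fst.fst.fst snd.fst.fst snd.fst snd))))))

end HeadComputable

end

namespace TunnelGadget

variable {G : TunnelGadget}

theorem exists_toNat_eq {d : ℕ} (hd : d < 2) : ∃ b : Bool, b.toNat = d := by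
  rcases (by omega : d = 0 ∨ d = 1) with rfl | rfl
  exacts [⟨false, rfl⟩, ⟨true, rfl⟩]

theorem natHasDistantOpening_iff : G.NatHasDistantOpening ↔ G.HasDistantOpening := by
  constructor
  · rintro ⟨s, hs, s', hs', t, ht, d, hd, u, hu, e, he, h1, h2, h3, h4⟩
    obtain ⟨d, rfl⟩ := exists_toNat_eq hd
    obtain ⟨e, rfl⟩ := exists_toNat_eq he
    refine ⟨⟨s, hs⟩, ⟨s', hs'⟩, (⟨t, ht⟩, d), (⟨u, hu⟩, e), natTrans_coe.1 h1, ?_,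
      mt natCanTraverse_coe.2 h3, natCanTraverse_coe.1 h4⟩
    simpa using h2
  · rintro ⟨s, s', ⟨t, d⟩, ⟨u, e⟩, h1, h2, h3, h4⟩
    exact ⟨s, s.2, s', s'.2, t, t.2, d.toNat, d.toNat_lt, u, u.2, e.toNat, e.toNat_lt,
      natTrans_coe.2 h1, fun h => h2 (Fin.ext h), mt natCanTraverse_coe.1 h3,
      natCanTraverse_coe.2 h4⟩

theorem ForcedByCode.forcedDistantClosingAt {s : Fin G.numStates} {t : Fin G.numTunnels}
    {d : Bool} {c : ℕ} (h : G.ForcedByCode s t d.toNat c) : G.ForcedDistantClosingAt s := by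
  classical
  set o : Fin G.numTunnels → Bool := fun u => decide (G.chosenDirection s c u = 1) with ho
  have hdir : ∀ u : Fin G.numTunnels, G.chosenDirection s c u = (o u).toNat := by
    intro u
    have : G.chosenDirection s c u < 2 := Nat.mod_lt _ two_pos
    rcases (by omega : G.chosenDirection s c u = 0 ∨ G.chosenDirection s c u = 1) with h | h <;>
      simp [ho, h]
  refine ⟨(t, d), Finset.univ.filter fun u => u ≠ t ∧ G.CanTraverse s (u, o u), o,
    natCanTraverse_coe.1 h.1, by simp, by simp, fun s' hs' => ?_⟩
  obtain ⟨u, hu, hut, h1, h2⟩ := h.2 s' s'.2 (natTrans_coe.2 hs')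
  rw [hdir ⟨u, hu⟩] at h1 h2
  refine ⟨⟨u, hu⟩, ?_, mt natCanTraverse_coe.2 h2⟩
  simp only [Finset.mem_filter, Finset.mem_univ, true_and]
  exact ⟨fun e => hut (congrArg Fin.val e), natCanTraverse_coe.1 h1⟩

/-- Every choice of directions for the open tunnels has a code. -/
theorem exists_code (G : TunnelGadget) (s k : ℕ) (o : ℕ → Bool) :
    ∃ c < 2 ^ G.openBelow s k, ∀ u < k, G.NatIsOpen s u →
      G.chosenDirection s c u = (o u).toNat := by
  classical
  refine ⟨Nat.ofBits fun i : Fin (G.openBelow s k) =>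
    decide (∃ u < k, G.NatIsOpen s u ∧ G.openBelow s u = i ∧ o u = true),
    Nat.ofBits_lt_two_pow _, fun u hu hopen => ?_⟩
  have hlt : G.openBelow s u < G.openBelow s k := Nat.count_strict_mono hopen hu
  rw [chosenDirection, ← Nat.toNat_testBit, Nat.testBit_ofBits_lt _ _ hlt]
  congr 1
  rw [Bool.eq_iff_iff, decide_eq_true_iff]
  constructor
  · rintro ⟨u', -, hopen', he, ho⟩
    rwa [← Nat.count_injective hopen' hopen he]
  · exact fun ho => ⟨u, hu, hopen, rfl, ho⟩

theorem ForcedDistantClosingAt.exists_forcedByCode {s : Fin G.numStates}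
    (h : G.ForcedDistantClosingAt s) :
    ∃ t < G.numTunnels, ∃ d < 2, ∃ c < 2 ^ G.openBelow s G.numTunnels,
      G.ForcedByCode s t d c := by
  obtain ⟨⟨t, d⟩, A, o, hp, htA, hA, h⟩ := h
  obtain ⟨c, hc, hco⟩ := G.exists_code s G.numTunnels
    fun u => if hu : u < G.numTunnels then o ⟨u, hu⟩ else false
  refine ⟨t, t.2, d.toNat, d.toNat_lt, c, hc, natCanTraverse_coe.2 hp, fun s' hs' hstep => ?_⟩
  obtain ⟨u, hu, hclosed⟩ := h ⟨s', hs'⟩ (natTrans_coe.1 hstep)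
  have hopen : G.NatIsOpen s u := natIsOpen_coe.2 ⟨_, hA u hu⟩
  have hdir : G.chosenDirection s c u = (o u).toNat := by simpa using hco u u.2 hopen
  refine ⟨u, u.2, fun e => htA (Fin.ext e ▸ hu), ?_, ?_⟩
  · rw [hdir]
    exact natCanTraverse_coe.2 (hA u hu)
  · rw [hdir]
    exact mt (natCanTraverse_coe (s := ⟨s', hs'⟩)).1 hclosed

theorem openBelow_numTunnels (s : Fin G.numStates) :
    G.openBelow s G.numTunnels = {t | G.IsOpen s t}.ncard := by
  classical
  rw [openBelow, Nat.count_eq_card_filter_range, ← Set.ncard_coe_finset,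
    ← Set.ncard_image_of_injective _ Fin.val_injective]
  congr 1
  ext t
  simp only [Finset.coe_filter, Finset.mem_range, Set.mem_ofPred_eq, Set.mem_image]
  constructor
  · rintro ⟨ht, h⟩
    exact ⟨⟨t, ht⟩, natIsOpen_coe.1 h, rfl⟩
  · rintro ⟨t, h, rfl⟩
    exact ⟨t.2, natIsOpen_coe.2 h⟩

/-- If more than `log₂` of the number of states many tunnels are open in some state, then the lower
bound on the number of reachable states fails, so that there is a forced distant closing. If not,
the number of codes is not cut off, and trying them all finds a forced distant closing. -/
theorem criterion_iff (hG : G.IsDAG) :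
    G.Criterion ↔ G.HasDistantOpening ∨ G.HasForcedDistantClosing := by
  rw [Criterion, natHasDistantOpening_iff]
  by_cases hno : G.HasDistantOpening
  · simp [hno]
  simp only [hno, false_or]
  constructor
  · rintro (⟨s, hs, h⟩ | ⟨s, hs, t, ht, d, hd, c, -, h⟩)
    · by_contra hF
      have h1 := two_pow_ncard_isOpen_le hG hno ⟨s, hs⟩ fun s' _ h => hF ⟨s', h⟩
      rw [← openBelow_numTunnels] at h1
      have h2 := Set.ncard_le_card {s' | G.Reachable ⟨s, hs⟩ s'}
      rw [Nat.card_fin] at h2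
      have h3 := h.trans_le (min_le_left _ _)
      exact absurd (h1.trans h2) (not_le.2 h3)
    · obtain ⟨d, rfl⟩ := exists_toNat_eq hd
      exact ⟨⟨s, hs⟩, h.forcedDistantClosingAt (t := ⟨t, ht⟩)⟩
  · rintro ⟨s, h⟩
    by_cases hs : G.numStates < min (2 ^ G.openBelow s G.numTunnels) (wordLength G)
    · exact Or.inl ⟨s, s.2, hs⟩
    · obtain ⟨t, ht, d, hd, c, hc, h⟩ := h.exists_forcedByCode
      have hL : G.numStates + G.numTunnels + 2 ≤ wordLength G := length_encode_ge
      exact Or.inr ⟨s, s.2, t, ht, d, hd, c, by omega, h⟩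

end TunnelGadget

theorem mainTheorem10 :
    (∃ f : {G : TunnelGadget // G.IsDAG} → Bool,
      (∀ G, f G = true ↔ (G.1.HasDistantOpening ∨ G.1.HasForcedDistantClosing)) ∧
      Nonempty (Turing.TM2ComputableInPolyTime
        (fun G : {G : TunnelGadget // G.IsDAG} => G.1.encode) Computability.encodeBool f)) ∧
    (∀ G : TunnelGadget, G.IsDAG → ¬ G.HasDistantOpening → ∀ s : Fin G.numStates,
      (∀ s', G.Reachable s s' → ¬ G.ForcedDistantClosingAt s') →
        2 ^ {t | G.IsOpen s t}.ncard ≤ {s' | G.Reachable s s'}.ncard) := by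
  classical
  refine ⟨⟨fun G => decide (G.1.HasDistantOpening ∨ G.1.HasForcedDistantClosing),
    fun G => by simp, ?_⟩, fun G hG hno s hF => TunnelGadget.two_pow_ncard_isOpen_le hG hno s hF⟩
  exact HeadComputable.criterion.polyTime (fun G : {G : TunnelGadget // G.IsDAG} => G.1) rfl _
    fun G => by rw [decide_eq_true_iff, TunnelGadget.criterion_iff G.2]
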